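/- Let $\mathbb F$ be a field, $V$ and $U$ vector spaces over $\mathbb F$, and $K\ge 1$, $N,S,A,T\ge 0$ integers; $V$ is assumed finite whenever $T>0$. The task is to compute $f(X_1),\dots,f(X_K)$ for a nonconstant $f:V\to U$ of degree $d$, with inputs $X_j\in V$, using $N$ workers. A *linear encoding* consists of an integer $c\ge 0$ and coefficients $G_{ij},H_{il}\in\mathbb F$; worker $i$ stores $\tilde X_i=\sum_{j=1}^K G_{ij}X_j+\sum_{l=1}^c H_{il}Z_l$, where $Z_1,\dots,Z_c$ are independent uniformly random keys in $V$ (keys are used only if $V$ is finite), and computes $f(\tilde X_i)$. It is *$T$-private* if $I\big(X;(\tilde X_i)_{i\in\mathcal T}\big)=0$ for every set $\mathcal T$ of at most $T$ workers, $X=(X_1,\dots,X_K)$ being uniform and independent of the keys. A *decoder* assigns to every set $\mathcal R$ of responding workers a function $h_{\mathcal R}:U^{\mathcal R}\to U^K$, deterministic or random but independent of the inputs and keys; it is *linear* if every output of $h_{\mathcal R}$ is a linear combination of the workers' results with coefficients in $\mathbb F$. A linear encoding *achieves* $(S,A,T)$ (with decoders of a given class) if it is $T$-private and some decoder of the class always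 (almost surely in its own randomness) returns $f(X_1),\dots,f(X_K)$ from the results of any set $\mathcal R$ with $|\mathcal R|\ge N-S$, even if up to $A$ of the results in $\mathcal R$ are replaced by arbitrary values. *Lagrange coded computing* (LCC) is the linear encoding $\tilde X_i=u(\alpha_i)$, where $u$ is the polynomial of degree at most $K+T-1$ with $u(\beta_j)=X_j$ for $j\le K$ and $u(\beta_{K+l})=Z_l$ for $1\le l\le T$, the $\beta$'s being distinct. In its standard form, used when $T>0$ or $N\ge Kd-1$, the $\alpha_i$ are distinct and, if $T>0$, different from $\beta_1,\dots,\beta_K$. In its uncoded (repetition) form, used otherwise, the $\alpha_i$ are taken in $\{\beta_1,\dots,\beta_K\}$ so that each $X_j$ is stored by $\lfloor N/K\rfloor$ to $\lceil N/K\rceil$ workers. Call *region condition* the inequality $$(K+T-1)d+S+2A+1\le N\ \text{ if } T>0 \text{ or } N\ge Kd-1,\qquad K(S+2A+1)\le N\ \text{ otherwise.}$$ **Theorem.** (a) Let $V=W_1\times\cdots\times W_d$ with $d\ge1$ and let $f$ be a nonzero multilinear map of its $d$ entries. If some linear encoding achieves $(S,A,T)$ with arbitrary decoders, then the region condition holds;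 conversely, if the region condition holds, then LCC, with any admissible choice of points in $\mathbb F$, achieves $(S,A,T)$. In particular, if $|\mathbb F|\ge N+K+T$, then admissible points exist and LCC achieves every $(S,A,T)$ achieved by some linear encoding. (b) Let $V,U$ be finite dimensional, and let $f$ be any nonconstant polynomial map of total degree $d$ (in the canonical representation, with individual degrees at most $|\mathbb F|-1$, if $\mathbb F$ is finite), where $\operatorname{char}\mathbb F$ is $0$ or greater than $d$. Then all statements of (a) hold for $f$ with $A=0$ and with linear decoders in place of arbitrary ones. -/

import Mathlib

universe u v v' w

namespace CodedComputing

open MeasureTheory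

/-- A linear encoding of `K` inputs for `N` workers: worker `i` stores a linear combination of the
inputs and of `numKeys` random keys, with fixed coefficients in `F`. -/
structure LinearEncoder (F : Type*) (K N : ℕ) where
  /-- the number of random keys -/
  numKeys : ℕ
  /-- the coefficient of each input at each worker -/
  dataCoeff : Fin N → Fin K → F
  /-- the coefficient of each key at each worker -/
  keyCoeff : Fin N → Fin numKeys → F

/-- A family of (deterministic) decoding functions, one for each set of responding workers. -/
abbrev Decoder (K N : ℕ) (U : Type*) : Type _ :=
  (R : Finset (Fin N)) → (R → U) → Fin K → U

/-- A decoder is linear when every output is a linear combination, with coefficients in `F`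
depending only on the set of responding workers, of the returned results. -/
def linearDecoders (F : Type*) [Field F] (K N : ℕ) (U : Type*) [AddCommGroup U] [Module F U] :
    Set (Decoder K N U) :=
  {h | ∀ R : Finset (Fin N), ∃ c : Fin K → R → F, ∀ (y : R → U) (k : Fin K),
    h R y k = ∑ i, c k i • y i}

/-- Mutual information of two random variables: the Kullback-Leibler divergence of their joint
law from the product of their laws. -/
noncomputable def mutualInfo {Ω α β : Type*} [MeasurableSpace Ω] [MeasurableSpace α]
    [MeasurableSpace β] (P : Measure Ω) (X : Ω → α) (Y : Ω → β) : ENNReal :=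
  InformationTheory.klDiv (P.map fun ω => (X ω, Y ω)) ((P.map X).prod (P.map Y))

namespace LinearEncoder

variable {F : Type*} [Field F] {K N : ℕ}

/-- The coded data stored at worker `i`, for inputs `X` and keys `Z`. -/
def encode (E : LinearEncoder F K N) {V : Type*} [AddCommGroup V] [Module F V]
    (X : Fin K → V) (Z : Fin E.numKeys → V) (i : Fin N) : V :=
  ∑ j, E.dataCoeff i j • X j + ∑ l, E.keyCoeff i l • Z l

/-- `T`-privacy over a finite space `V`: the inputs and the keys being independent and uniform, the
data stored at any set of at most `T` workers has zero mutual information with the inputs. -/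
def IsPrivate (E : LinearEncoder F K N) (V : Type*) [AddCommGroup V] [Module F V] (T : ℕ) : Prop :=
  letI : MeasurableSpace V := ⊤
  ∀ C : Finset (Fin N), C.card ≤ T →
    mutualInfo
      (ProbabilityTheory.uniformOn (Set.univ : Set ((Fin K → V) × (Fin E.numKeys → V))))
      Prod.fst
      (fun ω (i : C) => E.encode ω.1 ω.2 (i : Fin N)) = 0

/-- The random decoder `h` (with randomness `P`, not depending on the inputs and the keys) always
recovers `f (X 1), …, f (X K)` although at most `S` workers do not respond and at most `A` of the
responding workers return arbitrary results: `R` is the set of responding workers, and `y i` is what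
worker `i` returns. -/
def Decodes (E : LinearEncoder F K N) {V U : Type*} [AddCommGroup V] [Module F V]
    (f : V → U) (S A : ℕ) {Ω : Type*} [MeasurableSpace Ω] (P : Measure Ω)
    (h : Ω → Decoder K N U) : Prop :=
  ∀ (X : Fin K → V) (Z : Fin E.numKeys → V) (R : Finset (Fin N)), N ≤ R.card + S →
    ∀ y : R → U, {i : R | y i ≠ f (E.encode X Z i)}.ncard ≤ A →
      ∀ᵐ ω ∂P, h ω R y = fun k => f (X k)

/-- The encoder `E`, together with some (possibly random) decoder taken from the class `D`, is an
`S`-resilient, `A`-secure and `T`-private scheme for computing `f`. Uniform keys make sense only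
over a finite space. -/
def Achieves (E : LinearEncoder F K N) {V U : Type*} [AddCommGroup V] [Module F V]
    (D : Set (Decoder K N U)) (f : V → U) (S A T : ℕ) : Prop :=
  (E.numKeys ≠ 0 → Finite V) ∧ E.IsPrivate V T ∧
    ∃ (Ω : Type w) (_ : MeasurableSpace Ω) (P : Measure Ω) (h : Ω → Decoder K N U),
      IsProbabilityMeasure P ∧ (∀ ω, h ω ∈ D) ∧ E.Decodes f S A P h

end LinearEncoder

section LCC

variable {F : Type*} [Field F] {K N T : ℕ}

/-- The Lagrange encoder: worker `i` stores `u (α i)`, where `u` is the interpolation polynomial of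
degree at most `K + T - 1` that takes the inputs as values at the first `K` nodes `β` and the `T`
keys as values at the other nodes. -/
noncomputable def lagrangeEncoder (α : Fin N → F) (β : Fin K ⊕ Fin T → F) :
    LinearEncoder F K N where
  numKeys := T
  dataCoeff i j := (Lagrange.basis Finset.univ β (Sum.inl j)).eval (α i)
  keyCoeff i l := (Lagrange.basis Finset.univ β (Sum.inr l)).eval (α i)

/-- Points of the standard form of Lagrange coded computing. -/
def IsStandardPoints (α : Fin N → F) (β : Fin K ⊕ Fin T → F) : Prop :=
  Function.Injective α ∧ Function.Injective β ∧ (0 < T → ∀ i j, α i ≠ β (Sum.inl j))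

/-- Points of the uncoded form of Lagrange coded computing: the evaluation points are taken among
the first `K` nodes, so that each input is replicated at `⌊N / K⌋` to `⌈N / K⌉` workers. -/
def IsUncodedPoints (α : Fin N → F) (β : Fin K ⊕ Fin T → F) : Prop :=
  Function.Injective β ∧ ∃ σ : Fin N → Fin K, (∀ i, α i = β (Sum.inl (σ i))) ∧
    ∀ j, N / K ≤ {i | σ i = j}.ncard ∧ {i | σ i = j}.ncard ≤ N ⌈/⌉ K

/-- Points of Lagrange coded computing for a function of degree `d`: the standard form is used when
`T > 0` or `N ≥ K d - 1`, and the uncoded form otherwise. -/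
def IsLCCPoints (d : ℕ) (α : Fin N → F) (β : Fin K ⊕ Fin T → F) : Prop :=
  if 0 < T ∨ K * d ≤ N + 1 then IsStandardPoints α β else IsUncodedPoints α β

/-- The region of the triples `(S, A, T)`, given `N` workers, `K > 0` inputs and degree `d`. -/
def InRegion (N K d S A T : ℕ) : Prop :=
  if 0 < T ∨ K * d ≤ N + 1 then (K + T - 1) * d + S + 2 * A + 1 ≤ N
  else K * (S + 2 * A + 1) ≤ N

end LCC

section Polynomial

variable {F V U : Type*} [Field F] [AddCommGroup V] [Module F V] [AddCommGroup U] [Module F U]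
  {M L : ℕ}

/-- The map `V → U` whose coordinates are given by the polynomials `p`. -/
noncomputable def polyMap (b : Module.Basis (Fin M) F V) (c : Module.Basis (Fin L) F U)
    (p : Fin L → MvPolynomial (Fin M) F) (v : V) : U :=
  ∑ l, MvPolynomial.eval (fun m => b.repr v m) (p l) • c l

/-- The canonical representation of polynomials over a finite field: every individual degree is at
most `|F| - 1`. -/
def IsCanonical (p : Fin L → MvPolynomial (Fin M) F) : Prop :=
  Finite F → ∀ l m, (p l).degreeOf m ≤ Nat.card F - 1

/-- The total degree of a tuple of polynomials. -/
noncomputable def polyDegree (p : Fin L → MvPolynomial (Fin M) F) : ℕ :=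
  Finset.univ.sup fun l => (p l).totalDegree

end Polynomial

end CodedComputing

/-! All linear algebra takes place in the space of coefficient vectors on inputs and keys: worker
`i` is the vector `w_i` of its coefficients, input `j` a coordinate vector `e_j`.

Converse. Outside the region there are an input `j`, functionals `a_1, …, a_d` with `a_m(e_j) = 1`,
and a set `R` missing at most `S + 2A` workers, such that each worker of `R` is killed by some `a_m`
(`IsPrivate.exists_functionals`). If `f` is multilinear and `f(x) ≠ 0`, give inputs and keys the
`m`-th entry `a_m(·) x_m`. Worker `i` then returns `(∏ a_m(w_i)) f(x)`, which vanishes on `R` just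
as for zero data, whereas output `j` is `f(x) ≠ 0`; `S` erasures and `A` errors make the two
situations indistinguishable (`Decodes.eq_of_agree`). If `f` is polynomial, restrict a coordinate to
a line on which its degree is still `d`, and take the `d`-th finite difference over the inputs
attached to the sums of subsets of the `a_m`. It equals `d! p_d ∏ a_m`, commutes with linear
decoding, vanishes on `R`, and is nonzero at `e_j` by the assumption on the characteristic.

The functionals come from colouring `R` with `d` colours so that no class spans `e_j`
(`exists_coloring_notMem_span`), a matroid argument. Privacy enters as a rank bound: spanning `r >
0` data vectors takes rank at least `r + T` (`card_add_le_familyRank`). Uncrossing the sets with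
`|I| + c = d * rank I` yields an `e_j` outside all their spans; Edmonds' partition theorem, deduced
from Rado's, then colours the workers together with `c + 1` copies of `e_j`. All but `d - 1 - c`
workers of the chosen set survive: `c = 0` serves `T = 0`, and `c = d - 1` serves `T > 0`.

Achievability. Composing `f` with the Lagrange curve gives a polynomial curve of degree at most `(K
+ T - 1) d`, so enough honest results interpolate it; in the uncoded form a copy of each input
survives. -/

namespace CodedComputing

open Module Submodule

/-! ### Independent representatives (Rado). -/

section Rado

variable {F W ι : Type*} [Field F] [AddCommGroup W] [Module F W] [FiniteDimensional F W]

open Classical in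
/-- Rado's theorem for vector spaces: a finite family of finite sets of vectors has a linearly
independent system of representatives as soon as the union of any `k` of them has rank at least
`k`. -/
theorem exists_linearIndependent_representatives [Fintype ι] (A : ι → Finset W)
    (hA : ∀ J : Finset ι, J.card ≤ finrank F (span F (⋃ i ∈ J, (A i : Set W)))) :
    ∃ x : ι → W, (∀ i, x i ∈ A i) ∧ LinearIndependent F x := by
  induction hn : ∑ i, (A i).card using Nat.strong_induction_on generalizing A with
  | _ n ih =>
  subst hn
  have hne (i : ι) : (A i).Nonempty := by
    by_contra h
    have h1 := hA {i}
    simp [Finset.not_nonempty_iff_eq_empty.1 h] at h1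
  by_cases hcard : ∀ i, (A i).card ≤ 1
  · choose x hx using fun i => Finset.card_eq_one.1 (le_antisymm (hcard i) (hne i).card_pos)
    refine ⟨x, fun i => by simp [hx i], ?_⟩
    rw [linearIndependent_iff_card_le_finrank_span]
    have h := hA Finset.univ
    have h2 : (⋃ i ∈ Finset.univ, (A i : Set W)) = Set.range x := by
      ext w; simp [hx, eq_comm]
    rw [h2] at h
    simpa [Set.finrank] using h
  push Not at hcard
  obtain ⟨i₀, hi₀⟩ := hcard
  obtain ⟨x, hx, y, hy, hxy⟩ := Finset.one_lt_card.1 hi₀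
  -- If no representatives exist, then by induction deleting `z` from `A i₀` breaks the rank
  -- condition. The violating `J` must contain `i₀`, as the other index sets do not see the
  -- deletion.
  have key (z : W) (hz : z ∈ A i₀)
      (hbad : ¬∃ x : ι → W, (∀ i, x i ∈ A i) ∧ LinearIndependent F x) :
      ∃ J : Finset ι, i₀ ∈ J ∧ finrank F (span F ((⋃ i ∈ J.erase i₀, (A i : Set W)) ∪
        ((A i₀).erase z : Finset W))) < J.card := by
    by_contra hcon
    push Not at hcon
    refine hbad ?_
    have hlt : ∑ i, (Function.update A i₀ ((A i₀).erase z) i).card < ∑ i, (A i).card := by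
      refine Finset.sum_lt_sum (fun i _ => ?_) ⟨i₀, Finset.mem_univ _, ?_⟩
      · by_cases h : i = i₀
        · subst h; simpa using Finset.card_erase_le
        · simp [h]
      · simpa using Finset.card_erase_lt_of_mem hz
    have hupd : ∀ J : Finset ι, J.card ≤ finrank F (span F (⋃ i ∈ J,
        (Function.update A i₀ ((A i₀).erase z) i : Set W))) := by
      intro J
      by_cases hJ : i₀ ∈ J
      · refine (hcon J hJ).trans (finrank_mono (span_mono ?_))
        refine Set.union_subset (Set.iUnion₂_subset fun i hi => ?_) ?_
        · refine Set.subset_iUnion₂_of_subset i (Finset.mem_of_mem_erase hi) ?_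
          simp [Finset.ne_of_mem_erase hi]
        · refine Set.subset_iUnion₂_of_subset i₀ hJ ?_
          simp
      · refine (hA J).trans (finrank_mono (span_mono ?_))
        refine Set.iUnion₂_subset fun i hi => Set.subset_iUnion₂_of_subset i hi ?_
        have : i ≠ i₀ := fun h => hJ (h ▸ hi)
        simp [this]
    obtain ⟨u, hu, hind⟩ := ih _ hlt (Function.update A i₀ ((A i₀).erase z)) hupd rfl
    refine ⟨u, fun i => ?_, hind⟩
    have := hu i
    by_cases h : i = i₀
    · subst h; simp only [Function.update_self] at this; exact Finset.mem_of_mem_erase this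
    · simpa [h] using this
  by_contra hbad
  obtain ⟨J₁, h₁, hr₁⟩ := key x hx hbad
  obtain ⟨J₂, h₂, hr₂⟩ := key y hy hbad
  set P := span F ((⋃ i ∈ J₁.erase i₀, (A i : Set W)) ∪ ((A i₀).erase x : Finset W)) with hP
  set Q := span F ((⋃ i ∈ J₂.erase i₀, (A i : Set W)) ∪ ((A i₀).erase y : Finset W)) with hQ
  have hPi (i : ι) (hi : i ∈ J₁.erase i₀) : (A i : Set W) ⊆ P := fun w hw =>
    subset_span (Or.inl (Set.mem_biUnion hi hw))
  have hQi (i : ι) (hi : i ∈ J₂.erase i₀) : (A i : Set W) ⊆ Q := fun w hw =>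
    subset_span (Or.inl (Set.mem_biUnion hi hw))
  -- Since `x ≠ y`, each element of `A i₀` survives in `P` or in `Q`. The dimension formula then
  -- gives `|J₁ ∪ J₂| + |J₁ ∩ J₂| - 1 ≤ (|J₁| - 1) + (|J₂| - 1)`, which is absurd.
  have hsup : (J₁ ∪ J₂).card ≤ finrank F (P ⊔ Q : Submodule F W) := by
    refine (hA _).trans (finrank_mono (span_le.2 (Set.iUnion₂_subset fun i hi w hw => ?_)))
    by_cases h : i = i₀
    · subst h
      by_cases hwx : w = x
      · exact mem_sup_right (subset_span (Or.inr (by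
          subst hwx; exact Finset.mem_coe.2 (Finset.mem_erase.2 ⟨hxy, hw⟩))))
      · exact mem_sup_left (subset_span (Or.inr (Finset.mem_coe.2
          (Finset.mem_erase.2 ⟨hwx, hw⟩))))
    · rcases Finset.mem_union.1 hi with hi | hi
      · exact mem_sup_left (hPi i (Finset.mem_erase.2 ⟨h, hi⟩) hw)
      · exact mem_sup_right (hQi i (Finset.mem_erase.2 ⟨h, hi⟩) hw)
  have hinf : ((J₁ ∩ J₂).erase i₀).card ≤ finrank F (P ⊓ Q : Submodule F W) := by
    refine (hA _).trans (finrank_mono (span_le.2 (Set.iUnion₂_subset fun i hi w hw => ?_)))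
    have h := Finset.mem_erase.1 hi
    have h' := Finset.mem_inter.1 h.2
    exact ⟨hPi i (Finset.mem_erase.2 ⟨h.1, h'.1⟩) hw, hQi i (Finset.mem_erase.2 ⟨h.1, h'.2⟩) hw⟩
  have hdim := finrank_sup_add_finrank_inf_eq P Q
  have hc := Finset.card_union_add_card_inter J₁ J₂
  have he := Finset.card_erase_add_one (Finset.mem_inter.2 ⟨h₁, h₂⟩)
  omega

end Rado

/-! ### Rank of subfamilies and partition into independent sets (Edmonds). -/

section Rank

variable {F V ι : Type*} [Field F] [AddCommGroup V] [Module F V]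

/-- The rank of a subfamily of vectors. -/
noncomputable def familyRank (F : Type*) {V ι : Type*} [Field F] [AddCommGroup V] [Module F V]
    (v : ι → V) (I : Finset ι) : ℕ :=
  finrank F (span F (v '' I))

theorem LinearIndepOn.familyRank_eq {v : ι → V} {I : Finset ι}
    (h : LinearIndepOn F v (I : Set ι)) : familyRank F v I = I.card := by
  have := finrank_span_eq_card (R := F) h.linearIndependent
  rw [familyRank, Set.image_eq_range]
  simpa using this

theorem exists_linearIndepOn_card_eq_familyRank (v : ι → V) (I : Finset ι) :
    ∃ b ⊆ I, LinearIndepOn F v (b : Set ι) ∧ b.card = familyRank F v I ∧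
      span F (v '' b) = span F (v '' I) := by
  obtain ⟨b, hb, -, hspan, hind⟩ := exists_linearIndepOn_extension
    (linearIndepOn_empty F v) (Set.empty_subset (I : Set ι))
  lift b to Finset ι using I.finite_toSet.subset hb
  have heq : span F (v '' b) = span F (v '' I) :=
    le_antisymm (span_mono (Set.image_mono hb)) (span_le.2 hspan)
  refine ⟨b, by exact_mod_cast hb, hind, ?_, heq⟩
  rw [← LinearIndepOn.familyRank_eq hind, familyRank, familyRank, heq]

variable [FiniteDimensional F V]

theorem familyRank_mono (v : ι → V) {I J : Finset ι} (h : I ⊆ J) :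
    familyRank F v I ≤ familyRank F v J :=
  finrank_mono (span_mono (Set.image_mono (by exact_mod_cast h)))

theorem card_le_familyRank {v : ι → V} {I J : Finset ι}
    (h : LinearIndepOn F v (I : Set ι)) (hIJ : I ⊆ J) : I.card ≤ familyRank F v J := by
  rw [← LinearIndepOn.familyRank_eq h]
  exact familyRank_mono v hIJ

theorem span_eq_of_familyRank_le {v : ι → V} {I J : Finset ι} (h : I ⊆ J)
    (hr : familyRank F v J ≤ familyRank F v I) : span F (v '' I) = span F (v '' J) :=
  eq_of_le_of_finrank_le (span_mono (Set.image_mono (by exact_mod_cast h))) hr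

theorem familyRank_union_add_inter_le [DecidableEq ι] (v : ι → V) (I J : Finset ι) :
    familyRank F v (I ∪ J) + familyRank F v (I ∩ J) ≤ familyRank F v I + familyRank F v J := by
  rw [familyRank, familyRank, familyRank, familyRank,
    ← finrank_sup_add_finrank_inf_eq (span F (v '' I)) (span F (v '' J))]
  refine add_le_add (le_of_eq ?_) (finrank_mono (le_inf ?_ ?_))
  · rw [Finset.coe_union, Set.image_union, span_union]
  · exact span_mono (Set.image_mono (by simp))
  · exact span_mono (Set.image_mono (by simp))

open Classical in
/-- Edmonds' partition theorem for vector spaces. -/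
theorem exists_partition_linearIndepOn [Fintype ι] (v : ι → V) (d : ℕ)
    (h : ∀ J : Finset ι, J.card ≤ d * familyRank F v J) :
    ∃ col : ι → Fin d, ∀ m, LinearIndepOn F v {i | col i = m} := by
  -- Rado's theorem is applied to `d` copies of `V`, the `i`-th set holding the copies of `v i`:
  -- choosing a representative is choosing a colour. The copies of a basis of `span (v '' J)` give
  -- rank `d * rank J`.
  have hrep (J : Finset ι) : J.card ≤ finrank F (span F (⋃ i ∈ J, ((Finset.univ.image
      fun m : Fin d => Pi.single (M := fun _ => V) m (v i) : Finset (Fin d → V)) :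
        Set (Fin d → V)))) := by
    obtain ⟨b, hbJ, hb, hcard, -⟩ := exists_linearIndepOn_card_eq_familyRank (F := F) v J
    have hi := Pi.linearIndependent_single (fun (_ : Fin d) (i : (b : Set ι)) => v i)
      (fun _ => hb)
    have hc := finrank_span_eq_card hi
    refine (h J).trans ?_
    rw [← hcard]
    have hc' : d * b.card = Fintype.card (Σ _ : Fin d, (b : Set ι)) := by simp
    rw [hc', ← hc]
    refine finrank_mono (span_mono ?_)
    rintro _ ⟨⟨m, i⟩, rfl⟩
    simp only [Set.mem_iUnion, Finset.coe_image, Set.mem_image, Finset.mem_coe]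
    exact ⟨i, hbJ i.2, m, by simp, rfl⟩
  obtain ⟨x, hx, hind⟩ := exists_linearIndependent_representatives (F := F) _ hrep
  simp only [Finset.mem_image, Finset.mem_univ, true_and] at hx
  choose col hcol using hx
  refine ⟨col, fun m => ?_⟩
  refine LinearIndependent.of_comp (LinearMap.single F (fun _ : Fin d => V) m) ?_
  have hsub := hind.comp (Subtype.val : {i | col i = m} → ι) Subtype.val_injective
  have he : x ∘ (Subtype.val : {i | col i = m} → ι) =
      LinearMap.single F (fun _ : Fin d => V) m ∘ fun i : {i | col i = m} => v i := by
    funext ⟨i, hi⟩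
    obtain rfl : col i = m := hi
    exact (hcol i).symm
  rw [he] at hsub
  exact hsub

end Rank

end CodedComputing

namespace CodedComputing

open Module Submodule

/-! ### Colourings whose classes avoid a target vector. -/

section Coloring

variable {F V ι κ : Type*} [Field F] [AddCommGroup V] [Module F V]

open Classical in
/-- If each vector of a family lies in the span of a tight set (a nonempty set `I` with
`|I| + c = d * rank I`), then the ground set is large. -/
theorem exists_notMem_span_tight [FiniteDimensional F V] [Fintype κ] [Nonempty κ] {v : ι → V}
    {e : κ → V} {B : Finset ι} {c d T : ℕ} (hcT : c ≤ d * T)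
    (hrank : ∀ I ⊆ B, ∀ J : Finset κ, J.Nonempty → (∀ j ∈ J, e j ∈ span F (v '' I)) →
      J.card + T ≤ familyRank F v I)
    (hB : ∀ I ⊆ B, I.Nonempty → I.card + c ≤ d * familyRank F v I)
    (hcard : B.card + c < d * (Fintype.card κ + T)) :
    ∃ j, ∀ I ⊆ B, I.Nonempty → I.card + c = d * familyRank F v I → e j ∉ span F (v '' I) := by
  by_contra! hcon
  have hmax (j : κ) : ∃ P : Finset ι, Maximal (fun I => I ⊆ B ∧ I.Nonempty ∧
      I.card + c = d * familyRank F v I ∧ e j ∈ span F (v '' I)) P := by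
    obtain ⟨I, h1, h2, h3, h4⟩ := hcon j
    have hfin : {I : Finset ι | I ⊆ B ∧ I.Nonempty ∧
        I.card + c = d * familyRank F v I ∧ e j ∈ span F (v '' I)}.Finite :=
      B.powerset.finite_toSet.subset fun I hI => by simpa using hI.1
    obtain ⟨P, -, hP⟩ := hfin.exists_le_maximal (a := I) ⟨h1, h2, h3, h4⟩
    exact ⟨P, hP⟩
  choose P hP using hmax
  -- Uncrossing: by submodularity of rank, the union of two intersecting tight sets is tight, so
  -- maximal ones are equal or disjoint.
  have hunion (i j : κ) (h : (P i ∩ P j).Nonempty) : P i ∪ P j ≤ P i := by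
    obtain ⟨hi1, hi2, hi3, hi4⟩ := (hP i).prop
    obtain ⟨hj1, hj2, hj3, hj4⟩ := (hP j).prop
    refine (hP i).le_of_ge ⟨Finset.union_subset hi1 hj1, hi2.mono Finset.subset_union_left, ?_,
      span_mono (Set.image_mono (by simp)) hi4⟩ Finset.subset_union_left
    refine le_antisymm (hB _ (Finset.union_subset hi1 hj1)
      (hi2.mono Finset.subset_union_left)) ?_
    have h1 := hB _ (Finset.inter_subset_left.trans hi1) h
    have h2 := Nat.mul_le_mul_left d (familyRank_union_add_inter_le (F := F) v (P i) (P j))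
    rw [mul_add, mul_add] at h2
    have h3 := Finset.card_union_add_card_inter (P i) (P j)
    omega
  have hdisj : ∀ i j, P i ≠ P j → Disjoint (P i) (P j) := by
    intro i j hij
    by_contra h
    rw [Finset.not_disjoint_iff_nonempty_inter] at h
    refine hij (le_antisymm ?_ ?_)
    · rw [Finset.inter_comm] at h
      exact Finset.subset_union_right.trans (hunion j i h)
    · exact Finset.subset_union_right.trans (hunion i j h)
  set Ps := Finset.univ.image P with hPs
  have hB' : ∑ Q ∈ Ps, Q.card ≤ B.card := by
    have hpair : (Ps : Set (Finset ι)).PairwiseDisjoint id := by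
      intro Q hQ Q' hQ' hne
      obtain ⟨i, -, rfl⟩ := Finset.mem_image.1 (Finset.mem_coe.1 hQ)
      obtain ⟨j, -, rfl⟩ := Finset.mem_image.1 (Finset.mem_coe.1 hQ')
      exact hdisj i j hne
    have hcardU := Finset.card_biUnion hpair
    simp only [id] at hcardU
    rw [← hcardU]
    refine Finset.card_le_card (Finset.biUnion_subset.2 fun Q hQ => ?_)
    obtain ⟨j, -, rfl⟩ := Finset.mem_image.1 hQ
    exact (hP j).prop.1
  have hfib : ∑ Q ∈ Ps, (Finset.univ.filter fun j => P j = Q).card = Fintype.card κ :=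
    (Finset.card_eq_sum_card_image P Finset.univ).symm
  have hQ : ∀ Q ∈ Ps, d * (Finset.univ.filter fun j => P j = Q).card + d * T ≤ Q.card + c := by
    intro Q hQ
    obtain ⟨j, -, rfl⟩ := Finset.mem_image.1 hQ
    obtain ⟨h1, h2, h3, h4⟩ := (hP j).prop
    rw [h3, ← mul_add]
    refine Nat.mul_le_mul_left d (hrank _ h1 _ ⟨j, by simp⟩ fun i hi => ?_)
    rw [← (Finset.mem_filter.1 hi).2]
    exact (hP i).prop.2.2.2
  have hPsne : 1 ≤ Ps.card := Finset.card_pos.2 (Finset.univ_nonempty.image P)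
  have hsum := Finset.sum_le_sum hQ
  rw [Finset.sum_add_distrib, Finset.sum_add_distrib, ← Finset.mul_sum, hfib, Finset.sum_const,
    Finset.sum_const, smul_eq_mul, smul_eq_mul] at hsum
  -- With `k + 1` distinct sets the sum reads `d |κ| + (k + 1) d T ≤ |B| + (k + 1) c`; as `c ≤ d T`,
  -- the `k` surplus terms can be dropped, contradicting `hcard`.
  obtain ⟨k, hk⟩ := Nat.exists_eq_add_of_le hPsne
  rw [hk, add_mul, add_mul, one_mul, one_mul] at hsum
  have := Nat.mul_le_mul_left k hcT
  rw [mul_add] at hcard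
  omega

-- In the unique expansion of `x` over an independent set some coefficient is nonzero; removing that
-- vector takes `x` out of the span.
open Classical in
theorem exists_sdiff_notMem_span {v : ι → V} {C : Finset ι} (hC : LinearIndepOn F v (C : Set ι))
    {x : V} (hx : x ≠ 0) :
    ∃ D : Finset ι, D.card ≤ 1 ∧ x ∉ span F (v '' ((C \ D : Finset ι) : Set ι)) := by
  by_cases hmem : x ∈ span F (v '' (C : Set ι))
  · obtain ⟨a, ha⟩ := (mem_span_image_finset_iff_exists_fun' F).1 hmem
    obtain ⟨i, hi, hai⟩ : ∃ i ∈ C, a i ≠ 0 := by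
      by_contra! h
      exact hx (by rw [← ha]; exact Finset.sum_eq_zero fun i hi => by simp [h i hi])
    refine ⟨{i}, by simp, fun h => hai ?_⟩
    refine hC.eq_zero_of_smul_mem_span (Finset.mem_coe.2 hi) (a i) ?_
    rw [Finset.coe_sdiff, Finset.coe_singleton] at h
    rw [← Finset.add_sum_erase C _ hi, ← eq_sub_iff_add_eq] at ha
    rw [ha]
    refine sub_mem h (sum_mem fun k hk => smul_mem _ _ (subset_span ⟨k, ?_, rfl⟩))
    exact ⟨Finset.mem_of_mem_erase hk, Finset.ne_of_mem_erase hk⟩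
  · exact ⟨∅, by simp, by simpa using hmem⟩

open Classical in
/-- The combinatorial core of the converse: all but `d - 1 - c` members of a small family of vectors
can be divided into `d` classes, none of which spans some fixed target vector. -/
theorem exists_coloring_notMem_span [FiniteDimensional F V] [Fintype κ] [Nonempty κ] {v : ι → V}
    {e : κ → V} (he : ∀ j, e j ≠ 0) {s : Finset ι} {c d T : ℕ} (hcd : c < d) (hcT : c ≤ d * T)
    (hrank : ∀ I ⊆ s, ∀ J : Finset κ, J.Nonempty → (∀ j ∈ J, e j ∈ span F (v '' I)) →
      J.card + T ≤ familyRank F v I)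
    (hcard : s.card + c < d * (Fintype.card κ + T)) :
    ∃ j, ∃ col : ι → Fin d, ∃ R ⊆ s, s.card ≤ R.card + (d - 1 - c) ∧
      ∀ m, e j ∉ span F (v '' {i | i ∈ R ∧ col i = m}) := by
  have hfin : {B : Finset ι | B ⊆ s ∧ ∀ I ⊆ B, I.Nonempty →
      I.card + c ≤ d * familyRank F v I}.Finite :=
    s.powerset.finite_toSet.subset fun I hI => by simpa using hI.1
  obtain ⟨B, -, hBmax⟩ := hfin.exists_le_maximal (a := ∅) (by
    refine ⟨by simp, fun I hI hne => ?_⟩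
    simp [Finset.subset_empty.1 hI] at hne)
  obtain ⟨hBs, hB⟩ := hBmax.prop
  obtain ⟨j, hj⟩ := exists_notMem_span_tight hcT
    (fun I hI => hrank I (hI.trans hBs)) hB
    (lt_of_le_of_lt (Nat.add_le_add_right (Finset.card_le_card hBs) c) hcard)
  -- The `c + 1` copies of the target will reserve `c + 1` colour classes in which the members of
  -- `B` cannot span it.
  let v' : {i // i ∈ B} ⊕ Fin (c + 1) → V := Sum.elim (fun i => v i) (fun _ => e j)
  have hpart (J : Finset ({i // i ∈ B} ⊕ Fin (c + 1))) : J.card ≤ d * familyRank F v' J := by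
    set I : Finset ι := J.toLeft.map (Function.Embedding.subtype _) with hI
    have hIB : I ⊆ B := fun i hi => by
      obtain ⟨x, -, rfl⟩ := Finset.mem_map.1 hi; exact x.2
    have hcardJ : J.card = I.card + J.toRight.card := by
      rw [hI, Finset.card_map, Finset.card_toLeft_add_card_toRight]
    have hsub : v '' I ⊆ v' '' J := by
      rintro _ ⟨i, hi, rfl⟩
      obtain ⟨x, hx, rfl⟩ := Finset.mem_map.1 hi
      exact ⟨Sum.inl x, by simpa using hx, rfl⟩
    have hle : familyRank F v I ≤ familyRank F v' J := finrank_mono (span_mono hsub)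
    rcases J.toRight.eq_empty_or_nonempty with h0 | ⟨l, hl⟩
    · rcases I.eq_empty_or_nonempty with hI0 | hIne
      · simp [hcardJ, h0, hI0]
      · have := hB I hIB hIne
        have := Nat.mul_le_mul_left d hle
        simp only [hcardJ, h0, Finset.card_empty]
        omega
    · have hmem : e j ∈ span F (v' '' J) := subset_span ⟨Sum.inr l, by simpa using hl, rfl⟩
      have hr : J.toRight.card ≤ c + 1 := by simpa using Finset.card_le_univ J.toRight
      -- If `e j` lies in the span, `I` is not tight, so `|I| + c + 1 ≤ d * rank I` leaves room for
      -- all copies. Otherwise the rank grows by one, which gains `d ≥ c + 1`.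
      by_cases hmemI : e j ∈ span F (v '' I)
      · have hIne : I.Nonempty := by
          by_contra h
          rw [Finset.not_nonempty_iff_eq_empty] at h
          simp [h, he j] at hmemI
        have h1 := hB I hIB hIne
        have h2 : I.card + c ≠ d * familyRank F v I := fun h => hj I hIB hIne h hmemI
        have := Nat.mul_le_mul_left d hle
        omega
      · have hlt : familyRank F v I + 1 ≤ familyRank F v' J :=
          finrank_lt_finrank_of_lt (lt_of_le_of_ne (span_mono hsub) fun h => hmemI (h ▸ hmem))
        have h3 := Nat.mul_le_mul_left d hlt
        rw [mul_add, mul_one] at h3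
        rcases I.eq_empty_or_nonempty with hI0 | hIne
        · simp only [hcardJ, hI0, Finset.card_empty]; omega
        · have := hB I hIB hIne
          omega
  obtain ⟨col', hcol'⟩ := exists_partition_linearIndepOn v' d hpart
  let cls : Fin d → Finset ι := fun m =>
    (Finset.univ.filter fun x : {i // i ∈ B} => col' (Sum.inl x) = m).map
      (Function.Embedding.subtype _)
  have hcls (m : Fin d) (i : ι) : i ∈ cls m ↔ ∃ h : i ∈ B, col' (Sum.inl ⟨i, h⟩) = m := by
    simp [cls]
  have hclsind (m : Fin d) : LinearIndepOn F v (cls m : Set ι) := by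
    refine (hcol' m).linearIndependent.comp
      (fun i : (cls m : Set ι) => ⟨Sum.inl ⟨i, ((hcls m i).1 i.2).1⟩, ((hcls m i).1 i.2).2⟩) ?_
    intro i i' h
    have h' : (⟨i, _⟩ : {i // i ∈ B}) = ⟨i', _⟩ := Sum.inl_injective (congrArg Subtype.val h)
    exact Subtype.ext (congrArg (fun x : {i // i ∈ B} => (x : ι)) h')
  set M := Finset.univ.image fun l : Fin (c + 1) => col' (Sum.inr l) with hM
  have hinj : Function.Injective fun l : Fin (c + 1) => col' (Sum.inr l) := by
    intro l l' h
    have := (hcol' (col' (Sum.inr l'))).injOn (x₁ := Sum.inr l) (x₂ := Sum.inr l') h rfl rfl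
    simpa using this
  have hMcard : M.card = c + 1 := by
    rw [hM, Finset.card_image_of_injective _ hinj]; simp
  have hMspan : ∀ m ∈ M, e j ∉ span F (v '' cls m) := by
    intro m hm
    obtain ⟨l, -, rfl⟩ := Finset.mem_image.1 hm
    have := (hcol' (col' (Sum.inr l))).notMem_span (i := Sum.inr l) rfl
    refine fun h => this (span_mono ?_ h)
    rintro _ ⟨i, hi, rfl⟩
    obtain ⟨hiB, hi⟩ := (hcls _ _).1 hi
    exact ⟨Sum.inl ⟨i, hiB⟩, ⟨hi, by simp⟩, rfl⟩
  choose D hD1 hD2 using fun m => exists_sdiff_notMem_span (hclsind m) (he j)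
  -- A vector rejected by the maximal `B` already lies in the span of some reserved class, so adding
  -- it there does not change that span.
  have hout (i : ι) (hi : i ∈ s \ B) : ∃ m ∈ M, v i ∈ span F (v '' cls m) := by
    rw [Finset.mem_sdiff] at hi
    have hMne : M.Nonempty := Finset.card_pos.1 (by omega)
    have hnot : ¬ ∀ I ⊆ insert i B, I.Nonempty → I.card + c ≤ d * familyRank F v I := by
      intro h
      exact hi.2 (hBmax.le_of_ge ⟨Finset.insert_subset hi.1 hBs, h⟩
        (Finset.subset_insert i B) (Finset.mem_insert_self i B))
    push Not at hnot
    obtain ⟨I', hI', hne, hlt⟩ := hnot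
    have hiI' : i ∈ I' := by
      by_contra h
      have := hB I' ((Finset.subset_insert_iff_of_notMem h).1 hI') hne
      omega
    set I := I'.erase i with hI
    have hIB : I ⊆ B := Finset.subset_insert_iff.1 hI'
    have hIcard : I.card + 1 = I'.card := Finset.card_erase_add_one hiI'
    have hle := familyRank_mono (F := F) v (Finset.erase_subset i I')
    have hvi : v i ∈ span F (v '' I') := subset_span ⟨i, hiI', rfl⟩
    rcases I.eq_empty_or_nonempty with h0 | hIne
    -- Here `I' = {i}`, and the violated inequality with `c < d` forces `v i = 0`.
    · obtain ⟨m, hm⟩ := hMne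
      refine ⟨m, hm, ?_⟩
      have h1 : familyRank F v I' = 0 := by
        by_contra h
        have := Nat.mul_le_mul_left d (Nat.one_le_iff_ne_zero.2 h)
        simp [h0] at hIcard
        omega
      rw [familyRank, finrank_eq_zero] at h1
      rw [h1, mem_bot] at hvi
      rw [hvi]
      exact zero_mem _
    · have h1 := hB I hIB hIne
      have h2 := Nat.mul_le_mul_left d hle
      have h3 : d * familyRank F v I' = d * familyRank F v I := by
        rw [← hI] at h2
        omega
      have h4 : familyRank F v I' = familyRank F v I :=
        Nat.eq_of_mul_eq_mul_left (by omega) h3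
      rw [← span_eq_of_familyRank_le (Finset.erase_subset i I') h4.le] at hvi
      have hsum : I.card = ∑ m, (I ∩ cls m).card := by
        have hpair : ((Finset.univ : Finset (Fin d)) : Set (Fin d)).PairwiseDisjoint
            fun m => I ∩ cls m := by
          intro m _ m' _ hmm
          refine Finset.disjoint_left.2 fun x hx hx' => hmm ?_
          obtain ⟨h, h'⟩ := (hcls m x).1 (Finset.mem_inter.1 hx).2
          obtain ⟨k, k'⟩ := (hcls m' x).1 (Finset.mem_inter.1 hx').2
          exact h'.symm.trans k'
        rw [← Finset.card_biUnion hpair]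
        congr 1
        ext x
        simp only [Finset.mem_biUnion, Finset.mem_univ, true_and, Finset.mem_inter]
        exact ⟨fun hx => ⟨_, hx, (hcls _ _).2 ⟨hIB hx, rfl⟩⟩, fun ⟨_, hx, _⟩ => hx⟩
      have hall (m : Fin d) : (I ∩ cls m).card ≤ familyRank F v I :=
        card_le_familyRank ((hclsind m).mono (by simp)) Finset.inter_subset_left
      -- The violation makes `I` tight, so its `d` independent pieces miss full rank by only `c` in
      -- total. The `c + 1` reserved classes cannot all be deficient.
      obtain ⟨m, hm, hfull⟩ : ∃ m ∈ M, familyRank F v I ≤ (I ∩ cls m).card := by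
        by_contra! hcon
        have h5 : ∑ m, (I ∩ cls m).card + M.card ≤ ∑ _m : Fin d, familyRank F v I := by
          rw [Finset.card_eq_sum_ones, ← Finset.sum_filter_add_sum_filter_not Finset.univ (· ∈ M),
            ← Finset.sum_filter_add_sum_filter_not Finset.univ (· ∈ M) (fun _ => familyRank F v I)]
          have h6 : Finset.univ.filter (· ∈ M) = M := by simp
          rw [h6, add_right_comm, ← Finset.sum_add_distrib]
          exact add_le_add (Finset.sum_le_sum fun m hm => hcon m hm)
            (Finset.sum_le_sum fun m _ => hall m)
        simp only [Finset.sum_const, Finset.card_univ, Fintype.card_fin, smul_eq_mul] at h5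
        omega
      refine ⟨m, hm, ?_⟩
      have h7 : span F (v '' ((I ∩ cls m : Finset ι) : Set ι)) = span F (v '' I) := by
        refine span_eq_of_familyRank_le Finset.inter_subset_left ?_
        rwa [LinearIndepOn.familyRank_eq (I := I ∩ cls m) ((hclsind m).mono (by simp))]
      rw [← h7] at hvi
      exact span_mono (Set.image_mono (by simp)) hvi
  have : Nonempty (Fin d) := ⟨⟨0, by omega⟩⟩
  choose! out hout1 hout2 using hout
  -- Each of the `d - 1 - c` unreserved classes loses at most one vector; it never receives one from
  -- outside `B`.
  refine ⟨j, fun i => if h : i ∈ B then col' (Sum.inl ⟨i, h⟩) else out i,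
    s \ (Finset.univ \ M).biUnion D, Finset.sdiff_subset, ?_, fun m hmem => ?_⟩
  · have h1 : ((Finset.univ \ M).biUnion D).card ≤ d - 1 - c := by
      refine (Finset.card_biUnion_le_card_mul _ _ 1 fun m _ => hD1 m).trans ?_
      rw [mul_one, Finset.card_sdiff_of_subset (Finset.subset_univ _), hMcard]
      simp
      omega
    have := Finset.le_card_sdiff ((Finset.univ \ M).biUnion D) s
    omega
  · by_cases hm : m ∈ M
    · refine hMspan m hm (span_le.2 ?_ hmem)
      rintro _ ⟨i, ⟨hi, hcol⟩, rfl⟩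
      by_cases h : i ∈ B
      · simp only [h, dif_pos] at hcol
        exact subset_span ⟨i, (hcls m i).2 ⟨h, hcol⟩, rfl⟩
      · simp only [h, dif_neg, not_false_iff] at hcol
        rw [← hcol]
        exact hout2 i (Finset.mem_sdiff.2 ⟨(Finset.mem_sdiff.1 hi).1, h⟩)
    · refine hD2 m (span_mono (Set.image_mono ?_) hmem)
      rintro i ⟨hi, hcol⟩
      rw [Finset.mem_sdiff] at hi
      by_cases h : i ∈ B
      · simp only [h, dif_pos] at hcol
        refine Finset.mem_coe.2 (Finset.mem_sdiff.2 ⟨(hcls m i).2 ⟨h, hcol⟩, fun h' => hi.2 ?_⟩)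
        exact Finset.mem_biUnion.2 ⟨m, by simp [hm], h'⟩
      · simp only [h, dif_neg, not_false_iff] at hcol
        exact absurd (hcol ▸ hout1 i (Finset.mem_sdiff.2 ⟨hi.1, h⟩)) hm

end Coloring

end CodedComputing

namespace CodedComputing

open Module Submodule MeasureTheory ProbabilityTheory

/-! ### The rank bound behind privacy. -/

section Rank

variable {F V ι κ : Type*} [Field F] [AddCommGroup V] [Module F V]

open Classical in
/-- If any `T` of the vectors `v` only span `0` inside the span of the independent vectors `e`, then
`|J|` of the vectors `e` can only be spanned by a subfamily of `v` of rank at least `|J| + T`. -/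
theorem card_add_le_familyRank [FiniteDimensional F V] {v : ι → V} {e : κ → V} {T : ℕ}
    (he : LinearIndependent F e)
    (hT : ∀ C : Finset ι, C.card ≤ T → ∀ x ∈ span F (v '' C), x ∈ span F (Set.range e) → x = 0)
    (I : Finset ι) (J : Finset κ) (hJ : J.Nonempty) (hJI : ∀ j ∈ J, e j ∈ span F (v '' I)) :
    J.card + T ≤ familyRank F v I := by
  let w : κ ⊕ ι → V := Sum.elim e v
  have hind : LinearIndepOn F w ((J.disjSum ∅ : Finset (κ ⊕ ι)) : Set (κ ⊕ ι)) := by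
    let g : ((J.disjSum ∅ : Finset (κ ⊕ ι)) : Set (κ ⊕ ι)) → κ :=
      fun x => Sum.elim id (fun _ => hJ.choose) x.1
    have hmem (x : ((J.disjSum ∅ : Finset (κ ⊕ ι)) : Set (κ ⊕ ι))) : x.1 = Sum.inl (g x) := by
      obtain ⟨j | i, hx⟩ := x
      · rfl
      · simp at hx
    have hg : Function.Injective g := fun x y hxy => Subtype.ext (by rw [hmem x, hmem y, hxy])
    have hfun : (fun x : ((J.disjSum ∅ : Finset (κ ⊕ ι)) : Set (κ ⊕ ι)) => w x) = e ∘ g := by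
      funext x
      rw [hmem x]
      rfl
    rw [LinearIndepOn, hfun]
    exact he.comp g hg
  have hJI' : J.disjSum ∅ ⊆ J.disjSum I := Finset.disjSum_mono (Finset.Subset.refl _) (by simp)
  obtain ⟨b, hb, hJb, hspan, hbind⟩ := exists_linearIndepOn_extension hind
    (Finset.coe_subset.2 hJI')
  lift b to Finset (κ ⊕ ι) using (J.disjSum I).finite_toSet.subset hb
  have hb' : b ⊆ J.disjSum I := by exact_mod_cast hb
  have hJb' : J.disjSum ∅ ⊆ b := by exact_mod_cast hJb
  set C := b.toRight with hC
  have hleft : b.toLeft = J := by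
    ext j
    rw [Finset.mem_toLeft]
    exact ⟨fun h => by simpa using hb' h, fun h => hJb' (by simpa using h)⟩
  have hCI : C ⊆ I := fun i hi => by simpa using hb' (Finset.mem_toRight.1 hi)
  have hbcard : b.card = J.card + C.card := by
    rw [← hleft, hC, Finset.card_toLeft_add_card_toRight]
  have hwb : ∀ x ∈ b, w x ∈ span F (v '' I) := by
    rintro (j | i) hx
    · exact hJI j (by simpa using hb' hx)
    · exact subset_span ⟨i, by simpa using hb' hx, rfl⟩
  have hle : b.card ≤ familyRank F v I := by
    rw [← LinearIndepOn.familyRank_eq hbind]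
    refine finrank_mono (span_le.2 ?_)
    rintro _ ⟨x, hx, rfl⟩
    exact hwb x hx
  by_contra hcon
  have hCT : C.card < T := by omega
  -- Modulo `span (v '' C)`, each `v i` is a combination `x` of the `e`'s. Then `x` is spanned by
  -- `insert i C`, of size at most `T`, so it vanishes.
  have hI : span F (v '' I) ≤ span F (v '' C) := by
    refine span_le.2 ?_
    rintro _ ⟨i, hi, rfl⟩
    have h1 : v i ∈ span F (w '' b) := hspan ⟨Sum.inr i, by simpa using hi, rfl⟩
    have h2 : span F (w '' b) ≤ span F (Set.range e) ⊔ span F (v '' C) := by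
      refine span_le.2 ?_
      rintro _ ⟨(j | k), hx, rfl⟩
      · exact mem_sup_left (subset_span ⟨j, rfl⟩)
      · exact mem_sup_right (subset_span ⟨k, by simpa [hC] using hx, rfl⟩)
    obtain ⟨x, hx, y, hy, hxy⟩ := mem_sup.1 (h2 h1)
    have hx0 : x = 0 := by
      refine hT (insert i C) ((Finset.card_insert_le i C).trans hCT) x ?_ hx
      rw [← eq_sub_iff_add_eq] at hxy
      rw [hxy]
      exact sub_mem (subset_span ⟨i, by simp, rfl⟩)
        (span_mono (Set.image_mono (by simp)) hy)
    rw [hx0, zero_add] at hxy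
    exact hxy ▸ hy
  obtain ⟨j, hj⟩ := hJ
  exact he.ne_zero j (hT C hCT.le _ (hI (hJI j hj)) (subset_span ⟨j, rfl⟩))

end Rank

/-! ### Mutual information and its linear meaning. -/

section Privacy

theorem mutualInfo_eq_zero_iff {Ω α β : Type*} [MeasurableSpace Ω] [MeasurableSpace α]
    [MeasurableSpace β] {P : Measure Ω} [IsFiniteMeasure P] {X : Ω → α} {Y : Ω → β}
    (hX : Measurable X) (hY : Measurable Y) : mutualInfo P X Y = 0 ↔ IndepFun X Y P := by
  rw [indepFun_iff_map_prod_eq_prod_map_map hX.aemeasurable hY.aemeasurable, mutualInfo,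
    InformationTheory.klDiv_eq_zero_iff]

theorem uniformOn_univ_eq_ncard {Ω : Type*} [MeasurableSpace Ω] [MeasurableSingletonClass Ω]
    [Finite Ω] (s : Set Ω) :
    uniformOn (Set.univ : Set Ω) s = (s.ncard : ENNReal) / (Nat.card Ω : ENNReal) := by
  have := Fintype.ofFinite Ω
  rw [uniformOn_univ, Measure.count_apply s.toFinite.measurableSet, ← s.toFinite.cast_ncard_eq,
    Nat.card_eq_fintype_card]
  rfl

namespace LinearEncoder

variable {F : Type*} [Field F] {K N : ℕ} (E : LinearEncoder F K N)
  {V : Type*} [AddCommGroup V] [Module F V] {T : ℕ}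

/-- Over an infinite space there is no uniform distribution, and privacy is void. -/
theorem isPrivate_of_infinite (hK : 0 < K) (hV : Infinite V) : E.IsPrivate V T := by
  intro C _
  let _ : MeasurableSpace V := ⊤
  have : Nonempty (Fin K) := ⟨⟨0, hK⟩⟩
  have : Infinite (Fin K → V) := inferInstance
  have h : uniformOn (Set.univ : Set ((Fin K → V) × (Fin E.numKeys → V))) = 0 := by
    rw [uniformOn_eq_zero' MeasurableSet.univ]
    exact Or.inl Set.infinite_univ
  rw [mutualInfo, h]
  simp

/-- A scheme over a finite space is private if any change of the data can be compensated, as far as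
`T` workers can see, by a linear change of the keys. -/
theorem isPrivate_of_shift [Finite V]
    (h : ∀ C : Finset (Fin N), C.card ≤ T → ∃ z : Fin E.numKeys → Fin K → F,
      ∀ i ∈ C, ∀ j, E.dataCoeff i j + ∑ l, E.keyCoeff i l * z l j = 0) : E.IsPrivate V T := by
  intro C hC
  let _ : MeasurableSpace V := ⊤
  have : DiscreteMeasurableSpace V := ⟨fun _ => trivial⟩
  obtain ⟨z, hz⟩ := h C hC
  rw [mutualInfo_eq_zero_iff .of_discrete .of_discrete,
    indepFun_iff_measure_inter_preimage_eq_mul]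
  intro s t _ _
  set κ : (Fin K → V) → Fin E.numKeys → V := fun x l => ∑ j, z l j • x j with hκ
  set g : (Fin E.numKeys → V) → C → V := fun Z i => E.encode 0 Z i with hg
  -- This bijection preserves the data and the uniform law; after it the workers in `C` see a
  -- function of the keys alone, so independence reduces to counting a product set.
  let θ : ((Fin K → V) × (Fin E.numKeys → V)) ≃ ((Fin K → V) × (Fin E.numKeys → V)) :=
    { toFun := fun p => (p.1, p.2 + κ p.1)
      invFun := fun p => (p.1, p.2 - κ p.1)
      left_inv := fun p => by simp
      right_inv := fun p => by simp }
  have henc (p : (Fin K → V) × (Fin E.numKeys → V)) :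
      (fun i : C => E.encode (θ p).1 (θ p).2 i) = g p.2 := by
    funext i
    have h1 : ∀ j, (∑ l, E.keyCoeff i l * z l j) = - E.dataCoeff i j := fun j =>
      eq_neg_of_add_eq_zero_right (hz i i.2 j)
    have h2 : ∑ l, E.keyCoeff i l • ∑ j, z l j • p.1 j = - ∑ j, E.dataCoeff i j • p.1 j := by
      simp_rw [Finset.smul_sum, smul_smul]
      rw [Finset.sum_comm, ← Finset.sum_neg_distrib]
      refine Finset.sum_congr rfl fun j _ => ?_
      rw [← Finset.sum_smul, h1, neg_smul]
    simp only [hg, encode, θ, Equiv.coe_fn_mk, hκ, Pi.add_apply, smul_add, Finset.sum_add_distrib,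
      h2, Pi.zero_apply, smul_zero, Finset.sum_const_zero, zero_add]
    abel
  have hpre (u : Set ((Fin K → V) × (Fin E.numKeys → V))) : u.ncard = (θ ⁻¹' u).ncard := by
    rw [← Set.ncard_image_of_injective (θ ⁻¹' u) θ.injective, Set.image_preimage_eq _ θ.surjective]
  have hc1 : (Prod.fst ⁻¹' s ∩ (fun (ω : (Fin K → V) × (Fin E.numKeys → V)) (i : C) =>
      E.encode ω.1 ω.2 i) ⁻¹' t).ncard = s.ncard * (g ⁻¹' t).ncard := by
    rw [hpre, ← Set.ncard_prod]
    congr 1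
    ext p
    have := henc p
    simp only [Set.mem_preimage, Set.mem_inter_iff, Set.mem_prod]
    rw [this]
    rfl
  have hc2 : (Prod.fst ⁻¹' s : Set ((Fin K → V) × (Fin E.numKeys → V))).ncard =
      s.ncard * Nat.card (Fin E.numKeys → V) := by
    rw [← Set.ncard_univ, ← Set.ncard_prod, Set.prod_univ]
  have hc3 : ((fun (ω : (Fin K → V) × (Fin E.numKeys → V)) (i : C) =>
      E.encode ω.1 ω.2 i) ⁻¹' t).ncard = Nat.card (Fin K → V) * (g ⁻¹' t).ncard := by
    rw [hpre, ← Set.ncard_univ, ← Set.ncard_prod]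
    congr 1
    ext p
    have := henc p
    simp only [Set.mem_preimage, Set.mem_prod, Set.mem_univ, true_and]
    rw [this]
  rw [uniformOn_univ_eq_ncard, uniformOn_univ_eq_ncard, uniformOn_univ_eq_ncard, hc1, hc2, hc3,
    Nat.card_prod]
  have ha : (Nat.card (Fin K → V) : ℝ) ≠ 0 := by exact_mod_cast Nat.card_pos.ne'
  have hb : (Nat.card (Fin E.numKeys → V) : ℝ) ≠ 0 := by exact_mod_cast Nat.card_pos.ne'
  have hab : ((Nat.card (Fin K → V) * Nat.card (Fin E.numKeys → V) : ℕ) : ENNReal) ≠ 0 := by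
    exact_mod_cast (mul_pos Nat.card_pos Nat.card_pos).ne'
  rw [← ENNReal.toReal_eq_toReal_iff' (ENNReal.div_ne_top (ENNReal.natCast_ne_top _) hab)
    (ENNReal.mul_ne_top (ENNReal.div_ne_top (ENNReal.natCast_ne_top _) hab)
      (ENNReal.div_ne_top (ENNReal.natCast_ne_top _) hab))]
  simp only [ENNReal.toReal_div, ENNReal.toReal_mul, ENNReal.toReal_natCast, Nat.cast_mul]
  field_simp

theorem isPrivate_zero (hK : 0 < K) : E.IsPrivate V 0 := by
  rcases finite_or_infinite V with hV | hV
  · refine E.isPrivate_of_shift fun C hC => ⟨0, fun i hi => ?_⟩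
    rw [Nat.le_zero, Finset.card_eq_zero] at hC
    simp [hC] at hi
  · exact E.isPrivate_of_infinite hK hV

/-- In a private scheme, a linear relation between the keys used by `T` workers extends to the
data. -/
theorem IsPrivate.sum_dataCoeff_eq_zero {E : LinearEncoder F K N} [Finite V] [Nontrivial V]
    (h : E.IsPrivate V T) {C : Finset (Fin N)} (hC : C.card ≤ T) {a : Fin N → F}
    (ha : ∀ l, ∑ i ∈ C, a i * E.keyCoeff i l = 0) (j : Fin K) :
    ∑ i ∈ C, a i * E.dataCoeff i j = 0 := by
  by_contra hj
  have h := h C hC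
  revert h
  let _ : MeasurableSpace V := ⊤
  have : DiscreteMeasurableSpace V := ⟨fun _ => trivial⟩
  intro h
  rw [mutualInfo_eq_zero_iff .of_discrete .of_discrete,
    indepFun_iff_measure_inter_preimage_eq_mul] at h
  set φ : (Fin K → V) → V := fun x => ∑ j, (∑ i ∈ C, a i * E.dataCoeff i j) • x j with hφ
  have h := h {x | φ x ≠ 0} {y | ∑ i : C, a i • y i = 0} .of_discrete .of_discrete
  have hsum (X : Fin K → V) (Z : Fin E.numKeys → V) :
      ∑ i : C, a i • E.encode X Z i = φ X := by
    rw [Finset.sum_coe_sort C fun i => a i • E.encode X Z i]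
    simp only [encode, smul_add, Finset.sum_add_distrib, Finset.smul_sum, smul_smul]
    rw [Finset.sum_comm, Finset.sum_comm (t := Finset.univ) (s := C)]
    simp only [← Finset.sum_smul, ha, zero_smul, Finset.sum_const_zero, add_zero, hφ]
  -- The relation cancels the keys, so the workers could compute `φ X`. The two events exclude each
  -- other, yet both have positive probability, contradicting independence.
  have hempty : (Prod.fst ⁻¹' {x | φ x ≠ 0} ∩ (fun (ω : (Fin K → V) × (Fin E.numKeys → V))
      (i : C) => E.encode ω.1 ω.2 i) ⁻¹' {y | ∑ i : C, a i • y i = 0}) = ∅ := by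
    refine Set.eq_empty_of_forall_notMem fun ω hω => hω.1 ?_
    rw [← hsum ω.1 ω.2]
    exact hω.2
  rw [hempty, measure_empty] at h
  obtain ⟨x, hx⟩ := exists_ne (0 : V)
  have hpos (u : Set ((Fin K → V) × (Fin E.numKeys → V))) (hu : u.Nonempty) :
      uniformOn Set.univ u ≠ 0 := by
    rw [uniformOn_univ_eq_ncard]
    refine ENNReal.div_ne_zero.2 ⟨?_, ENNReal.natCast_ne_top _⟩
    exact_mod_cast (Set.ncard_pos u.toFinite).2 hu |>.ne'
  rcases mul_eq_zero.1 h.symm with h | h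
  · refine hpos _ ⟨(Pi.single j x, 0), ?_⟩ h
    simp only [Set.mem_preimage, Set.mem_ofPred_eq, hφ]
    rw [Finset.sum_eq_single j (fun k _ hk => by simp [hk]) (by simp)]
    simpa using ⟨hj, hx⟩
  · refine hpos _ ⟨(0, 0), ?_⟩ h
    simp only [Set.mem_preimage, Set.mem_ofPred_eq, hsum]
    simp [hφ]

/-- The vector of all coefficients used by a worker. -/
def workerVector (i : Fin N) : (Fin K → F) × (Fin E.numKeys → F) :=
  (E.dataCoeff i, E.keyCoeff i)

/-- The coordinate vector of an input. -/
def dataVector (j : Fin K) : (Fin K → F) × (Fin E.numKeys → F) :=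
  (Pi.single j 1, 0)

theorem dataVector_linearIndependent : LinearIndependent F E.dataVector := by
  refine LinearIndependent.of_comp (LinearMap.fst F _ _) ?_
  exact Pi.linearIndependent_single_one (Fin K) F

theorem snd_eq_zero_of_mem_span_dataVector {x : (Fin K → F) × (Fin E.numKeys → F)}
    (hx : x ∈ span F (Set.range E.dataVector)) : x.2 = 0 := by
  have : span F (Set.range E.dataVector) ≤ LinearMap.ker (LinearMap.snd F (Fin K → F) _) := by
    refine span_le.2 ?_
    rintro _ ⟨j, rfl⟩
    simp [dataVector]
  exact this hx

-- Privacy in the form needed by `card_add_le_familyRank`: if a combination of at most `T` worker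
-- vectors has no key part, its data part vanishes too. For `T = 0` this is trivial and needs no
-- finiteness.
open Classical in
theorem eq_zero_of_mem_span_workerVector (h : 0 < T → Finite V ∧ Nontrivial V)
    (hE : E.IsPrivate V T) {C : Finset (Fin N)} (hC : C.card ≤ T)
    {x : (Fin K → F) × (Fin E.numKeys → F)} (hx : x ∈ span F (E.workerVector '' C))
    (hx' : x ∈ span F (Set.range E.dataVector)) : x = 0 := by
  rcases Nat.eq_zero_or_pos T with rfl | hT
  · rw [Nat.le_zero, Finset.card_eq_zero] at hC
    simpa [hC] using hx
  · obtain ⟨hV, hV'⟩ := h hT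
    obtain ⟨a, rfl⟩ := (mem_span_image_finset_iff_exists_fun' F).1 hx
    have h2 := E.snd_eq_zero_of_mem_span_dataVector hx'
    have h1 := IsPrivate.sum_dataCoeff_eq_zero hE hC (a := a) fun l => by
      simpa [workerVector, Prod.snd_sum] using congrFun h2 l
    ext j
    · simpa [workerVector, Prod.fst_sum] using h1 j
    · rw [h2]; rfl

end LinearEncoder

end Privacy

end CodedComputing

namespace CodedComputing

open Module Submodule MeasureTheory ProbabilityTheory

/-! ### Functionals on the coefficient space. -/

namespace LinearEncoder

variable {F : Type*} [Field F] {K N : ℕ} (E : LinearEncoder F K N)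

/-- The coordinate vector of a key. -/
def keyVector (l : Fin E.numKeys) : (Fin K → F) × (Fin E.numKeys → F) :=
  (0, Pi.single l 1)

theorem workerVector_eq_sum (i : Fin N) : E.workerVector i =
    ∑ j, E.dataCoeff i j • E.dataVector j + ∑ l, E.keyCoeff i l • E.keyVector l := by
  ext k <;> simp [workerVector, dataVector, keyVector, Prod.fst_sum, Prod.snd_sum, Pi.single_apply]

/-- A functional prescribes inputs and keys along a fixed `w`; by linearity every worker stores the
functional's value at its own vector. -/
theorem encode_functional {V : Type*} [AddCommGroup V] [Module F V]
    (a : Dual F ((Fin K → F) × (Fin E.numKeys → F))) (w : V) (i : Fin N) :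
    E.encode (fun k => a (E.dataVector k) • w) (fun l => a (E.keyVector l) • w) i =
      a (E.workerVector i) • w := by
  rw [workerVector_eq_sum]
  simp [encode, Finset.sum_smul, add_smul, smul_smul]

theorem exists_functional_of_notMem_span {F W : Type*} [Field F] [AddCommGroup W] [Module F W]
    {x : W} {s : Set W} (hx : x ∉ span F s) :
    ∃ a : Dual F W, a x = 1 ∧ ∀ y ∈ s, a y = 0 := by
  obtain ⟨a, ha, hs⟩ := exists_dual_map_eq_bot_of_notMem hx inferInstance
  refine ⟨(a x)⁻¹ • a, by simp [ha], fun y hy => ?_⟩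
  have : a y ∈ (span F s).map a := mem_map_of_mem (subset_span hy)
  rw [hs, mem_bot] at this
  simp [this]

variable {E} {V : Type*} [AddCommGroup V] [Module F V] {T : ℕ}

/-- One functional separates `e_j` from each colour class. Taking `d' > d` allows fewer colours than
factors of `f`: the extra functionals only need the value `1` at `e_j`. -/
theorem IsPrivate.exists_functionals_of_card (hE : E.IsPrivate V T) (hK : 0 < K)
    (hV : 0 < T → Finite V ∧ Nontrivial V) {s : Finset (Fin N)} {c d d' : ℕ} (hcd : c < d)
    (hd : d ≤ d') (hcT : c ≤ d * T) (hs : s.card + c < d * (K + T)) :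
    ∃ j, ∃ R ⊆ s, s.card ≤ R.card + (d - 1 - c) ∧
      ∃ a : Fin d' → Dual F ((Fin K → F) × (Fin E.numKeys → F)),
        (∀ m, a m (E.dataVector j) = 1) ∧ ∀ i ∈ R, ∃ m, a m (E.workerVector i) = 0 := by
  have : Nonempty (Fin K) := ⟨⟨0, hK⟩⟩
  have hli := E.dataVector_linearIndependent
  obtain ⟨j, col, R, hRs, hcard, hR⟩ := exists_coloring_notMem_span (F := F)
    (v := E.workerVector) (fun j => hli.ne_zero j) hcd hcT
    (fun I _ J hJ hJI => card_add_le_familyRank hli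
      (fun C hC x hx hx' => E.eq_zero_of_mem_span_workerVector hV hE hC hx hx') I J hJ hJI)
    (s := s) (by simpa using hs)
  have hex (m : Fin d') : ∃ a : Dual F ((Fin K → F) × (Fin E.numKeys → F)),
      a (E.dataVector j) = 1 ∧
        ∀ i ∈ R, Fin.castLE hd (col i) = m → a (E.workerVector i) = 0 := by
    have hmem : E.dataVector j ∉
        span F (E.workerVector '' {i | i ∈ R ∧ Fin.castLE hd (col i) = m}) := by
      by_cases hm : (m : ℕ) < d
      · have hset : {i | i ∈ R ∧ Fin.castLE hd (col i) = m} = {i | i ∈ R ∧ col i = ⟨m, hm⟩} := by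
          ext i
          simp [Fin.ext_iff]
        rw [hset]
        exact hR ⟨m, hm⟩
      · have hempty : {i | i ∈ R ∧ Fin.castLE hd (col i) = m} = ∅ := by
          refine Set.eq_empty_of_forall_notMem fun i hi => hm ?_
          rw [← hi.2]
          exact (col i).2
        rw [hempty]
        simpa using hli.ne_zero j
    obtain ⟨a, ha, h0⟩ := exists_functional_of_notMem_span hmem
    exact ⟨a, ha, fun i hi hc => h0 _ ⟨i, ⟨hi, hc⟩, rfl⟩⟩
  choose a ha h0 using hex
  exact ⟨j, R, hRs, hcard, a, ha, fun i hi => ⟨_, h0 _ i hi rfl⟩⟩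

/-- Outside of the region, there are a data coordinate `j`, a set `R` of workers missing at most
`S + 2 A` workers, and `d` functionals equal to `1` at `j`, one of which vanishes at each worker
of `R`. -/
theorem IsPrivate.exists_functionals (hE : E.IsPrivate V T) (hK : 0 < K)
    (hV : 0 < T → Finite V ∧ Nontrivial V) {d S A : ℕ} (hd : 0 < d)
    (hreg : ¬InRegion N K d S A T) :
    ∃ j, ∃ R : Finset (Fin N), N ≤ R.card + (S + 2 * A) ∧
      ∃ a : Fin d → Dual F ((Fin K → F) × (Fin E.numKeys → F)),
        (∀ m, a m (E.dataVector j) = 1) ∧ ∀ i ∈ R, ∃ m, a m (E.workerVector i) = 0 := by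
  unfold InRegion at hreg
  obtain ⟨k, rfl⟩ : ∃ k, K = k + 1 := ⟨K - 1, by omega⟩
  rcases Nat.eq_zero_or_pos T with rfl | hT
  · by_cases hN : (k + 1) * d ≤ N + 1
    · simp only [hN, or_true, if_true] at hreg
      have hexp : (k + 1) * d = k * d + d := by ring
      obtain ⟨s, -, hs⟩ := Finset.exists_subset_card_eq (s := (Finset.univ : Finset (Fin N)))
        (n := (k + 1) * d - 1) (by simp; omega)
      obtain ⟨j, R, -, hR, h⟩ := hE.exists_functionals_of_card hK hV (s := s) (c := 0) hd le_rfl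
        (by simp) (by rw [hs, mul_comm d]; simp only [add_zero]; omega)
      refine ⟨j, R, ?_, h⟩
      simp only [add_zero, Nat.add_sub_cancel] at hreg
      omega
    · simp only [hN, lt_irrefl, or_self, if_false] at hreg
      rw [not_le] at hN hreg
      -- With few workers, `⌊N/K⌋ + 1` colours suffice for all of them, and only `⌊N/K⌋ ≤ S + 2A`
      -- workers are lost.
      have h1 : N / (k + 1) < d := Nat.div_lt_of_lt_mul (by omega)
      have h2 : N / (k + 1) < S + 2 * A + 1 := Nat.div_lt_of_lt_mul hreg
      have h3 : N < (N / (k + 1) + 1) * (k + 1) := by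
        rw [mul_comm]; exact Nat.lt_mul_div_succ N hK
      obtain ⟨j, R, -, hR, h⟩ := hE.exists_functionals_of_card hK hV (s := Finset.univ) (c := 0)
        (d := N / (k + 1) + 1) (d' := d) (Nat.succ_pos _) h1 (by simp) (by simpa using h3)
      refine ⟨j, R, ?_, h⟩
      simp only [Finset.card_univ, Fintype.card_fin] at hR
      omega
  · simp only [hT, true_or, if_true] at hreg
    have h1 : (k + 1 + T - 1) * d = k * d + T * d := by
      rw [← add_mul]; congr 1; omega
    have h2 : d * (k + 1 + T) = k * d + T * d + d := by ring
    have h3 : d ≤ d * T := Nat.le_mul_of_pos_right d hT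
    obtain ⟨s, -, hs⟩ := Finset.exists_subset_card_eq (s := (Finset.univ : Finset (Fin N)))
        (n := min N (k * d + T * d)) (by simp)
    -- As `T > 0`, `c = d - 1` satisfies `c ≤ d T`, and no worker of `s` is lost.
    obtain ⟨j, R, -, hR, h⟩ := hE.exists_functionals_of_card hK hV (s := s) (c := d - 1)
      (d := d) (by omega) le_rfl (by omega) (by rw [hs, h2]; omega)
    refine ⟨j, R, ?_, h⟩
    omega

end LinearEncoder

/-! ### Finite differences and restriction to lines. -/

section FiniteDifference

open Polynomial

variable {F : Type*} [Field F]

theorem coeff_taylor_sub_self (P : F[X]) (r : F) {n : ℕ} (hP : P.natDegree ≤ n + 1) :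
    (taylor r P - P).natDegree ≤ n ∧
      (taylor r P - P).coeff n = (n + 1) * P.coeff (n + 1) * r := by
  constructor
  · rw [natDegree_le_iff_coeff_eq_zero]
    intro k hk
    rw [coeff_sub, taylor_coeff]
    have h0 : (hasseDeriv k P).natDegree < 1 :=
      lt_of_le_of_lt (natDegree_hasseDeriv_le P k) (by omega)
    rw [eval_eq_sum_range' h0]
    simp [hasseDeriv_coeff]
  · rw [coeff_sub, taylor_coeff]
    have h0 : (hasseDeriv n P).natDegree < 2 :=
      lt_of_le_of_lt (natDegree_hasseDeriv_le P n) (by omega)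
    rw [eval_eq_sum_range' h0]
    simp [Finset.sum_range_succ, hasseDeriv_coeff, add_comm 1 n]

open Classical in
/-- The iterated finite difference of a polynomial of degree at most the number of steps. -/
theorem sum_powerset_neg_one_pow_eval {ι : Type*} (s : Finset ι) (a : ι → F) (P : F[X])
    (hP : P.natDegree ≤ s.card) (x : F) :
    ∑ S ∈ s.powerset, (-1) ^ (s.card - S.card) * P.eval (x + ∑ m ∈ S, a m) =
      s.card.factorial * P.coeff s.card * ∏ m ∈ s, a m := by
  induction s using Finset.induction_on generalizing P with
  | empty =>
    have h0 : P.natDegree < 1 := by simpa using hP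
    simp [eval_eq_sum_range' h0]
  | insert m s hm ih =>
    rw [Finset.card_insert_of_notMem hm] at hP ⊢
    obtain ⟨h1, h2⟩ := coeff_taylor_sub_self P (a m) hP
    have h := ih _ h1
    rw [h2] at h
    rw [Finset.sum_powerset_insert hm, Finset.prod_insert hm, Nat.factorial_succ]
    calc _ = ∑ S ∈ s.powerset, (-1) ^ (s.card - S.card) *
          (taylor (a m) P - P).eval (x + ∑ m ∈ S, a m) := by
          rw [← Finset.sum_add_distrib]
          refine Finset.sum_congr rfl fun S hS => ?_
          have hSs := Finset.mem_powerset.1 hS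
          have hmS : m ∉ S := fun h => hm (hSs h)
          have hc := Finset.card_le_card hSs
          rw [Finset.card_insert_of_notMem hmS, Finset.sum_insert hmS, Nat.add_sub_add_right,
            Nat.sub_add_comm hc, pow_succ, eval_sub, taylor_eval]
          rw [show x + ∑ m ∈ S, a m + a m = x + (a m + ∑ m ∈ S, a m) by ring]
          ring
      _ = _ := by
          rw [h]
          push_cast
          ring

theorem coeff_aeval_line {M : ℕ} (p : MvPolynomial (Fin M) F) (w : Fin M → F) (n : ℕ) :
    (MvPolynomial.aeval (fun m => C (w m) * X) p : F[X]).coeff n =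
      MvPolynomial.eval w (MvPolynomial.homogeneousComponent n p) := by
  induction p using MvPolynomial.induction_on' with
  | monomial e c =>
    have h1 : (MvPolynomial.aeval (fun m => C (w m) * X) (MvPolynomial.monomial e c) : F[X]) =
        C (c * e.prod fun m k => w m ^ k) * X ^ e.degree := by
      rw [MvPolynomial.aeval_monomial]
      simp only [mul_pow, Finsupp.prod_mul, map_mul, map_finsuppProd, map_pow, mul_assoc]
      congr 2
      simp only [Finsupp.prod, Finset.prod_pow_eq_pow_sum]
      rfl
    rw [h1, MvPolynomial.homogeneousComponent_of_mem
      ((MvPolynomial.mem_homogeneousSubmodule _ _).2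
        (MvPolynomial.isHomogeneous_monomial c rfl))]
    split_ifs with h
    · rw [MvPolynomial.eval_monomial, coeff_C_mul, coeff_X_pow, if_pos h, mul_one]
    · rw [map_zero, coeff_C_mul, coeff_X_pow, if_neg h, mul_zero]
  | add p q hp hq => simp [hp, hq]

end FiniteDifference

end CodedComputing

namespace CodedComputing

open Module Submodule MeasureTheory ProbabilityTheory

/-! ### The converse bounds. -/

section Converse

variable {F : Type*} [Field F] {K N : ℕ}

/-- If two choices of inputs and keys lead to the same results at all but `S + 2 A` workers, then
they have the same outputs. -/
theorem LinearEncoder.Decodes.eq_of_agree {E : LinearEncoder F K N} {V U : Type*} [AddCommGroup V]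
    [Module F V] {f : V → U} {S A : ℕ} {Ω : Type*} [MeasurableSpace Ω] {P : Measure Ω}
    [IsProbabilityMeasure P] {h : Ω → Decoder K N U} (hdec : E.Decodes f S A P h)
    {R : Finset (Fin N)} (hR : N ≤ R.card + (S + 2 * A)) {X X' : Fin K → V}
    {Z Z' : Fin E.numKeys → V} (heq : ∀ i ∈ R, f (E.encode X Z i) = f (E.encode X' Z' i))
    (k : Fin K) : f (X k) = f (X' k) := by
  classical
  have hc : (Finset.univ \ R).card + R.card = N := by
    simpa using Finset.card_sdiff_add_card_eq_card (Finset.subset_univ R)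
  obtain ⟨B, hB, hBcard⟩ := Finset.exists_subset_card_eq (s := Finset.univ \ R)
    (n := min A (Finset.univ \ R).card) (by simp)
  have hc' := Finset.card_sdiff_add_card_eq_card hB
  obtain ⟨B', hB', hBcard'⟩ := Finset.exists_subset_card_eq (s := (Finset.univ \ R) \ B)
    (n := min A ((Finset.univ \ R) \ B).card) (by simp)
  have hdisj : Disjoint B B' := by
    refine Finset.disjoint_left.2 fun i hi hi' => ?_
    exact (Finset.mem_sdiff.1 (hB' hi')).2 hi
  have hdisj' : Disjoint R (B ∪ B') := by
    refine Finset.disjoint_left.2 fun i hi hi' => ?_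
    rcases Finset.mem_union.1 hi' with hi' | hi'
    · exact (Finset.mem_sdiff.1 (hB hi')).2 hi
    · exact (Finset.mem_sdiff.1 (Finset.mem_sdiff.1 (hB' hi')).1).2 hi
  have hcard : (R ∪ (B ∪ B')).card = R.card + (B.card + B'.card) := by
    rw [Finset.card_union_of_disjoint hdisj', Finset.card_union_of_disjoint hdisj]
  have hRS : N ≤ (R ∪ (B ∪ B')).card + S := by omega
  -- These results differ from the honest ones of `(X, Z)` only on `B'`, and from those of `(X',
  -- Z')` only on `B`; each set has at most `A` workers.
  let y : (R ∪ (B ∪ B') : Finset (Fin N)) → U := fun i =>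
    if (i : Fin N) ∈ B then f (E.encode X Z i) else f (E.encode X' Z' i)
  have hle (D : Finset (Fin N)) (hD : D.card ≤ A) (g : Fin N → U)
      (hg : ∀ i : (R ∪ (B ∪ B') : Finset (Fin N)), y i ≠ g i → (i : Fin N) ∈ D) :
      {i : (R ∪ (B ∪ B') : Finset (Fin N)) | y i ≠ g i}.ncard ≤ A := by
    rw [← Set.ncard_image_of_injective _ Subtype.val_injective]
    refine (Set.ncard_le_ncard (t := (D : Set (Fin N))) ?_ D.finite_toSet).trans ?_
    · rintro _ ⟨i, hi, rfl⟩
      exact hg i hi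
    · rwa [Set.ncard_coe_finset]
  have h1 := hdec X Z _ hRS y (hle B' (by omega) (fun i => f (E.encode X Z i)) fun i hi => by
    by_contra hiB'
    refine hi ?_
    by_cases hiB : (i : Fin N) ∈ B
    · simp [y, hiB]
    · have hiR : (i : Fin N) ∈ R := by
        have := i.2
        simp only [Finset.mem_union, hiB, hiB', or_false] at this
        exact this
      simp [y, hiB, heq i hiR])
  have h2 := hdec X' Z' _ hRS y (hle B (by omega) (fun i => f (E.encode X' Z' i)) fun i hi => by
    by_contra hiB
    exact hi (by simp [y, hiB]))
  obtain ⟨ω, hω1, hω2⟩ := (h1.and h2).exists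
  exact congrFun (hω1.symm.trans hω2) k

theorem inRegion_of_achieves_multilinear {U : Type*} [AddCommGroup U] [Module F U] (hK : 0 < K)
    {S A T d : ℕ} {W : Fin d → Type*} [∀ j, AddCommGroup (W j)] [∀ j, Module F (W j)]
    {f : MultilinearMap F W U} (hd : 0 < d) (hf : f ≠ 0) (hT : 0 < T → Finite (∀ j, W j))
    {E : LinearEncoder F K N} (hE : E.Achieves.{w} Set.univ (fun x => f x) S A T) :
    InRegion N K d S A T := by
  obtain ⟨-, hpriv, Ω, _, P, h, hP, -, hdec⟩ := hE
  by_contra hreg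
  have : Nonempty (Fin d) := ⟨⟨0, hd⟩⟩
  obtain ⟨x, hx⟩ : ∃ x, f x ≠ 0 := by
    by_contra! hcon
    exact hf (MultilinearMap.ext hcon)
  have hnt : Nontrivial (∀ j, W j) := ⟨x, 0, fun h0 => hx (by rw [h0, f.map_zero])⟩
  obtain ⟨j, R, hR, a, ha, h0⟩ := hpriv.exists_functionals hK (fun h => ⟨hT h, hnt⟩) hd hreg
  have henc (i : Fin N) : E.encode (fun k m => a m (E.dataVector k) • x m)
      (fun l m => a m (E.keyVector l) • x m) i = fun m => a m (E.workerVector i) • x m := by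
    funext m
    rw [← E.encode_functional (a m) (x m) i]
    simp [LinearEncoder.encode]
  have key := hdec.eq_of_agree hR (X := fun k m => a m (E.dataVector k) • x m)
    (Z := fun l m => a m (E.keyVector l) • x m) (X' := 0) (Z' := 0) (fun i hi => by
      obtain ⟨m, hm⟩ := h0 i hi
      rw [henc, f.map_smul_univ, Finset.prod_eq_zero (Finset.mem_univ m) hm, zero_smul]
      simp only [LinearEncoder.encode, Pi.zero_apply, smul_zero, Finset.sum_const_zero, add_zero]
      exact f.map_zero.symm) j
  simp only [ha, one_smul, Pi.zero_apply] at key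
  exact hx (key.trans f.map_zero)

/-- The restriction to a line of a coordinate of a polynomial map. -/
theorem exists_line_polynomial {V U : Type*} [AddCommGroup V] [Module F V] [AddCommGroup U]
    [Module F U] {M L : ℕ} (b : Basis (Fin M) F V) (c : Basis (Fin L) F U)
    (p : Fin L → MvPolynomial (Fin M) F) (hd : 0 < polyDegree p)
    (hchar : ringChar F = 0 ∨ polyDegree p < ringChar F) :
    ∃ (x : V) (l : Fin L) (P : Polynomial F), P.natDegree ≤ polyDegree p ∧
      P.coeff (polyDegree p) ≠ 0 ∧ ∀ r : F, c.repr (polyMap b c p (r • x)) l = P.eval r := by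
  have hne : (Finset.univ : Finset (Fin L)).Nonempty := by
    by_contra h
    rw [Finset.not_nonempty_iff_eq_empty] at h
    simp [polyDegree, h] at hd
  obtain ⟨l, -, hl⟩ := Finset.exists_mem_eq_sup Finset.univ hne fun l => (p l).totalDegree
  have hl : polyDegree p = (p l).totalDegree := hl
  rw [hl] at hd hchar ⊢
  have hcomp : MvPolynomial.homogeneousComponent (p l).totalDegree (p l) ≠ 0 := by
    obtain ⟨e, he, hdeg⟩ := Finset.exists_mem_eq_sup (p l).support (by
      rw [Finset.nonempty_iff_ne_empty, Ne, MvPolynomial.support_eq_empty]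
      intro h
      simp [h] at hd) fun s => s.sum fun _ e => e
    intro h
    have h2 := MvPolynomial.coeff_homogeneousComponent (p l).totalDegree (p l) e
    rw [h, MvPolynomial.coeff_zero, if_pos] at h2
    · exact MvPolynomial.mem_support_iff.1 he h2.symm
    · exact hdeg.symm
  -- A nonzero form of degree at most `|F|` has a nonzero value; for finite `F` the bound holds
  -- because `|F|` is at least the characteristic.
  have hcard : ((p l).totalDegree : Cardinal) ≤ Cardinal.mk F := by
    rcases finite_or_infinite F with hF | hF
    · rw [← Nat.cast_card, Nat.cast_le]
      rcases hchar with h | h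
      · have : CharZero F := (CharP.ringChar_zero_iff_CharZero F).1 h
        exact absurd (Infinite.of_injective (Nat.cast : ℕ → F) Nat.cast_injective)
          (not_infinite_iff_finite.2 hF)
      · refine h.le.trans ?_
        have := Fintype.ofFinite F
        rw [Nat.card_eq_fintype_card]
        exact Nat.le_of_dvd Fintype.card_pos (ringChar.dvd (Nat.cast_card_eq_zero F))
    · exact (Cardinal.natCast_le_aleph0).trans (Cardinal.infinite_iff.1 hF)
  obtain ⟨z, hz⟩ : ∃ z, MvPolynomial.eval z
      (MvPolynomial.homogeneousComponent (p l).totalDegree (p l)) ≠ 0 := by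
    by_contra! hcon
    exact hcomp ((MvPolynomial.homogeneousComponent_isHomogeneous _
      (p l)).eq_zero_of_forall_eval_eq_zero_of_le_card hcon hcard)
  refine ⟨b.equivFun.symm z, l, MvPolynomial.aeval
    (fun m => Polynomial.C (z m) * Polynomial.X) (p l), ?_, ?_, fun r => ?_⟩
  · refine (MvPolynomial.aeval_natDegree_le (p l) le_rfl _ (n := 1) fun m => ?_).trans (by simp)
    exact (Polynomial.natDegree_C_mul_le _ _).trans Polynomial.natDegree_X_le
  · rwa [coeff_aeval_line]
  · have h1 : c.repr (polyMap b c p (r • b.equivFun.symm z)) l = MvPolynomial.eval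
        (fun m => b.repr (r • b.equivFun.symm z) m) (p l) := by
      simp [polyMap, Finsupp.single_apply]
    have h2 : ∀ m, b.repr (r • b.equivFun.symm z) m = z m * r := fun m => by
      have := congrFun (b.equivFun.apply_symm_apply z) m
      rw [Basis.equivFun_apply] at this
      rw [map_smul, Finsupp.smul_apply, this, smul_eq_mul, mul_comm]
    rw [h1]
    simp only [h2]
    rw [← Polynomial.coe_evalRingHom, MvPolynomial.aeval_def, MvPolynomial.hom_eval₂]
    change MvPolynomial.eval₂ (RingHom.id F) _ _ = _
    congr 1
    · ext; simp
    · ext m; simp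

theorem factorial_cast_ne_zero_of_lt_ringChar {d : ℕ} (h : ringChar F = 0 ∨ d < ringChar F) :
    (d.factorial : F) ≠ 0 := by
  intro h0
  have hdvd := ringChar.dvd h0
  rcases h with h | h
  · rw [h, zero_dvd_iff] at hdvd
    exact d.factorial_ne_zero hdvd
  · have hp : (ringChar F).Prime :=
      (CharP.char_is_prime_or_zero F (ringChar F)).resolve_right (by omega)
    exact absurd ((hp.dvd_factorial).1 hdvd) (by omega)

theorem polyDegree_pos_of_ne {V U : Type*} [AddCommGroup V] [Module F V] [AddCommGroup U]
    [Module F U] {M L : ℕ} {b : Basis (Fin M) F V} {c : Basis (Fin L) F U}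
    {p : Fin L → MvPolynomial (Fin M) F} (h : ∃ x y, polyMap b c p x ≠ polyMap b c p y) :
    0 < polyDegree p := by
  obtain ⟨x, y, hxy⟩ := h
  by_contra h0
  refine hxy (Finset.sum_congr rfl fun l _ => ?_)
  have hl : (p l).totalDegree = 0 := by
    have := Finset.le_sup (f := fun l => (p l).totalDegree) (Finset.mem_univ l)
    rw [polyDegree] at h0
    omega
  rw [MvPolynomial.totalDegree_eq_zero_iff_eq_C.1 hl]
  simp

theorem inRegion_of_achieves_polynomial {V U : Type*} [AddCommGroup V] [Module F V]
    [AddCommGroup U] [Module F U] (hK : 0 < K) {S T M L : ℕ} (b : Basis (Fin M) F V)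
    (c : Basis (Fin L) F U) (p : Fin L → MvPolynomial (Fin M) F)
    (hne : ∃ x y, polyMap b c p x ≠ polyMap b c p y)
    (hchar : ringChar F = 0 ∨ polyDegree p < ringChar F) (hT : 0 < T → Finite V)
    {E : LinearEncoder F K N}
    (hE : E.Achieves.{w} (linearDecoders F K N U) (polyMap b c p) S 0 T) :
    InRegion N K (polyDegree p) S 0 T := by
  classical
  have hd := polyDegree_pos_of_ne hne
  have hnt : Nontrivial V := by
    obtain ⟨x, y, hxy⟩ := hne
    exact ⟨x, y, fun h => hxy (h ▸ rfl)⟩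
  obtain ⟨d, hddef⟩ : ∃ d, d = polyDegree p := ⟨_, rfl⟩
  obtain ⟨x, l, P, hPdeg, hPcoeff, hP⟩ := exists_line_polynomial b c p hd hchar
  rw [← hddef] at hd hchar hPdeg hPcoeff ⊢
  obtain ⟨-, hpriv, Ω, _, μ, h, hμ, hlin, hdec⟩ := hE
  by_contra hreg
  obtain ⟨j, R, hR, a, ha, h0⟩ := hpriv.exists_functionals hK (fun h => ⟨hT h, hnt⟩) hd hreg
  -- There are only `2 ^ d` inputs to test, so a single outcome of the randomness, hence a single
  -- linear decoder, serves them all.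
  have hae : ∀ᵐ ω ∂μ, ∀ s : Finset (Fin d),
      h ω R (fun i => polyMap b c p ((∑ m ∈ s, a m) (E.workerVector i) • x)) j =
        polyMap b c p ((∑ m ∈ s, a m) (E.dataVector j) • x) := by
    rw [ae_all_iff]
    intro s
    have := hdec (fun k => (∑ m ∈ s, a m) (E.dataVector k) • x)
      (fun l => (∑ m ∈ s, a m) (E.keyVector l) • x) R (by omega)
      (fun i => polyMap b c p ((∑ m ∈ s, a m) (E.workerVector i) • x))
      (by simp only [E.encode_functional, ne_eq, not_true_eq_false]; simp)
    filter_upwards [this] with ω hω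
    rw [hω]
  obtain ⟨ω, hω⟩ := hae.exists
  obtain ⟨coef, hcoef⟩ := hlin ω R
  have hdiff (z : (Fin K → F) × (Fin E.numKeys → F)) :
      ∑ s ∈ (Finset.univ : Finset (Fin d)).powerset, (-1) ^ (d - s.card) *
        P.eval ((∑ m ∈ s, a m) z) = d.factorial * P.coeff d * ∏ m, a m z := by
    have := sum_powerset_neg_one_pow_eval (Finset.univ : Finset (Fin d)) (fun m => a m z) P
      (by simpa using hPdeg) 0
    simpa using this
  have hP' (s : Finset (Fin d)) : P.eval ((∑ m ∈ s, a m) (E.dataVector j)) =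
      ∑ i : R, coef j i * P.eval ((∑ m ∈ s, a m) (E.workerVector i)) := by
    have := hω s
    rw [hcoef] at this
    rw [← hP, ← this]
    simp only [map_sum, map_smul, Finsupp.coe_finsetSum, Finset.sum_apply, Finsupp.smul_apply, hP,
      smul_eq_mul]
  have h1 := hdiff (E.dataVector j)
  rw [Finset.prod_eq_one fun m _ => ha m, mul_one] at h1
  simp only [hP', Finset.mul_sum] at h1
  rw [Finset.sum_comm] at h1
  refine mul_ne_zero (factorial_cast_ne_zero_of_lt_ringChar hchar) hPcoeff (h1.symm.trans ?_)
  refine Finset.sum_eq_zero fun i _ => ?_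
  have h2 := hdiff (E.workerVector i)
  obtain ⟨m, hm⟩ := h0 i i.2
  rw [Finset.prod_eq_zero (Finset.mem_univ m) hm, mul_zero] at h2
  rw [← mul_zero (coef j i), ← h2, Finset.mul_sum]
  exact Finset.sum_congr rfl fun s _ => by ring

end Converse

end CodedComputing

namespace CodedComputing

open Module Submodule MeasureTheory ProbabilityTheory Polynomial

/-! ### Vector-valued polynomial curves. -/

section PolyCurve

variable {F U : Type*} [Field F] [AddCommGroup U] [Module F U]

/-- The vector-valued polynomial functions of degree at most `D`. -/
def polyCurves (F U : Type*) [Field F] [AddCommGroup U] [Module F U] (D : ℕ) :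
    Submodule F (F → U) :=
  span F {g | ∃ (P : F[X]) (x : U), P.natDegree ≤ D ∧ g = fun t => P.eval t • x}

theorem smul_mem_polyCurves {D : ℕ} {P : F[X]} (hP : P.natDegree ≤ D) (x : U) :
    (fun t => P.eval t • x) ∈ polyCurves F U D :=
  subset_span ⟨P, x, hP, rfl⟩

/-- Lagrange interpolation for vector-valued polynomials. -/
theorem eq_sum_basis_of_mem_polyCurves {D : ℕ} {g : F → U} (hg : g ∈ polyCurves F U D) {ι : Type*}
    [DecidableEq ι] (s : Finset ι) {α : ι → F} (hα : Set.InjOn α s) (hD : D < s.card) (t : F) :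
    g t = ∑ i ∈ s, (Lagrange.basis s α i).eval t • g (α i) := by
  induction hg using span_induction with
  | mem g hg =>
    obtain ⟨P, x, hP, rfl⟩ := hg
    have hdeg : P.degree < s.card :=
      lt_of_le_of_lt degree_le_natDegree (by exact_mod_cast lt_of_le_of_lt hP hD)
    have h := congrArg (eval t) (Lagrange.eq_interpolate hα hdeg)
    rw [Lagrange.interpolate_apply, eval_finsetSum] at h
    simp only [eval_mul, eval_C] at h
    dsimp only
    rw [h, Finset.sum_smul]
    exact Finset.sum_congr rfl fun i _ => by rw [smul_smul, mul_comm]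
  | zero => simp
  | add g g' _ _ h h' =>
    simp only [Pi.add_apply, smul_add, Finset.sum_add_distrib]
    rw [h, h']
  | smul a g _ h =>
    simp only [Pi.smul_apply]
    rw [h, Finset.smul_sum]
    exact Finset.sum_congr rfl fun i _ => smul_comm _ _ _

end PolyCurve

/-! ### Privacy and decoding of Lagrange coded computing. -/

section Lagrange

variable {F : Type*} [Field F] {K N T : ℕ} {V : Type*} [AddCommGroup V] [Module F V]

/-- The interpolating curve through the points `x` at the nodes `β`. -/
noncomputable def lagrangeCurve {ι : Type*} [Fintype ι] [DecidableEq ι] (β : ι → F) (x : ι → V)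
    (t : F) : V :=
  ∑ j, (Lagrange.basis Finset.univ β j).eval t • x j

theorem lagrangeCurve_node {ι : Type*} [Fintype ι] [DecidableEq ι] {β : ι → F}
    (hβ : Function.Injective β) (x : ι → V) (j : ι) : lagrangeCurve β x (β j) = x j := by
  rw [lagrangeCurve, Finset.sum_eq_single j]
  · rw [Lagrange.eval_basis_self hβ.injOn (Finset.mem_univ j), one_smul]
  · intro k _ hk
    rw [Lagrange.eval_basis_of_ne hk (Finset.mem_univ j), zero_smul]
  · simp

theorem natDegree_basis_le {ι : Type*} [Fintype ι] [DecidableEq ι] {β : ι → F}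
    (hβ : Function.Injective β) (j : ι) :
    (Lagrange.basis Finset.univ β j).natDegree ≤ Fintype.card ι - 1 :=
  natDegree_le_of_degree_le (Lagrange.degree_basis hβ.injOn (Finset.mem_univ j)).le

theorem lagrangeEncoder_encode (α : Fin N → F) (β : Fin K ⊕ Fin T → F) (X : Fin K → V)
    (Z : Fin T → V) (i : Fin N) :
    (lagrangeEncoder α β).encode X Z i = lagrangeCurve β (Sum.elim X Z) (α i) := by
  simp only [LinearEncoder.encode, lagrangeCurve, lagrangeEncoder, Fintype.sum_sum_type,
    Sum.elim_inl, Sum.elim_inr]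
  rfl

theorem multilinear_comp_lagrangeCurve_mem {U : Type*} [AddCommGroup U] [Module F U] {d : ℕ}
    {W : Fin d → Type*} [∀ j, AddCommGroup (W j)] [∀ j, Module F (W j)] (f : MultilinearMap F W U)
    {ι : Type*} [Fintype ι] [DecidableEq ι] {β : ι → F} (hβ : Function.Injective β)
    (x : ι → ∀ j, W j) :
    (fun t => f (lagrangeCurve β x t)) ∈ polyCurves F U ((Fintype.card ι - 1) * d) := by
  have h : (fun t => f (lagrangeCurve β x t)) = ∑ r : Fin d → ι, fun t =>
      (∏ m, Lagrange.basis Finset.univ β (r m)).eval t • f fun m => x (r m) m := by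
    funext t
    have h1 : lagrangeCurve β x t =
        fun m => ∑ j, (Lagrange.basis Finset.univ β j).eval t • x j m := by
      funext m
      simp [lagrangeCurve]
    rw [h1, f.map_sum, Finset.sum_apply]
    refine Finset.sum_congr rfl fun r _ => ?_
    rw [f.map_smul_univ, eval_prod]
  rw [h]
  refine sum_mem fun r _ => smul_mem_polyCurves ?_ _
  refine (natDegree_prod_le _ _).trans ?_
  refine (Finset.sum_le_card_nsmul _ _ _ fun m _ => natDegree_basis_le hβ (r m)).trans ?_
  simp [mul_comm]

theorem polyMap_comp_lagrangeCurve_mem {U : Type*} [AddCommGroup U] [Module F U] {M L : ℕ}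
    (b : Basis (Fin M) F V) (c : Basis (Fin L) F U) (p : Fin L → MvPolynomial (Fin M) F)
    {ι : Type*} [Fintype ι] [DecidableEq ι] {β : ι → F} (hβ : Function.Injective β) (x : ι → V) :
    (fun t => polyMap b c p (lagrangeCurve β x t)) ∈
      polyCurves F U ((Fintype.card ι - 1) * polyDegree p) := by
  let q : Fin M → F[X] := fun m => ∑ j, C (b.repr (x j) m) * Lagrange.basis Finset.univ β j
  have hq (t : F) (m : Fin M) : (q m).eval t = b.repr (lagrangeCurve β x t) m := by
    simp [q, lagrangeCurve, eval_finsetSum, mul_comm]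
  have hqdeg (m : Fin M) : (q m).natDegree ≤ Fintype.card ι - 1 :=
    natDegree_sum_le_of_forall_le _ _ fun j _ =>
      (natDegree_C_mul_le _ _).trans (natDegree_basis_le hβ j)
  have h : (fun t => polyMap b c p (lagrangeCurve β x t)) = ∑ l, fun t =>
      (MvPolynomial.aeval q (p l)).eval t • c l := by
    funext t
    rw [Finset.sum_apply]
    refine Finset.sum_congr rfl fun l _ => ?_
    congr 1
    rw [← coe_evalRingHom, MvPolynomial.aeval_def, MvPolynomial.hom_eval₂]
    change MvPolynomial.eval₂ (RingHom.id F) _ _ = _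
    congr 1
    · ext; simp
    · ext m; simp [hq]
  rw [h]
  refine sum_mem fun l _ => smul_mem_polyCurves ?_ _
  rw [mul_comm]
  exact MvPolynomial.aeval_natDegree_le (p l)
    (Finset.le_sup (f := fun l => (p l).totalDegree) (Finset.mem_univ l)) q hqdeg

/-- Over the region, the outputs are fixed linear combinations of the results of any set of workers
missing at most `S + 2 A` workers. -/
theorem exists_coeff_of_inRegion {U : Type*} [AddCommGroup U] [Module F U] {f : V → U} (hK : 0 < K)
    {d S A : ℕ} (hreg : InRegion N K d S A T) {α : Fin N → F} {β : Fin K ⊕ Fin T → F}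
    (hpts : IsLCCPoints d α β)
    (hf : Function.Injective β → ∀ x : Fin K ⊕ Fin T → V,
      (fun t => f (lagrangeCurve β x t)) ∈ polyCurves F U ((K + T - 1) * d))
    {R : Finset (Fin N)} (hR : N ≤ R.card + (S + 2 * A)) :
    ∃ c : Fin K → Fin N → F, ∀ (X : Fin K → V) (Z : Fin T → V) (k : Fin K),
      f (X k) = ∑ i ∈ R, c k i • f ((lagrangeEncoder α β).encode X Z i) := by
  classical
  unfold InRegion at hreg
  unfold IsLCCPoints at hpts
  by_cases hcase : 0 < T ∨ K * d ≤ N + 1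
  · rw [if_pos hcase] at hreg hpts
    obtain ⟨hα, hβ, -⟩ := hpts
    refine ⟨fun k i => (Lagrange.basis R α i).eval (β (Sum.inl k)), fun X Z k => ?_⟩
    -- The region condition gives `|R| ≥ N - S - 2A > (K + T - 1) d`, enough to interpolate the
    -- curve.
    have h := eq_sum_basis_of_mem_polyCurves (hf hβ (Sum.elim X Z)) R hα.injOn (by omega)
      (β (Sum.inl k))
    rw [lagrangeCurve_node hβ] at h
    simpa only [lagrangeEncoder_encode, Sum.elim_inl] using h
  · rw [if_neg hcase] at hreg hpts
    obtain ⟨hβ, σ, hσ, hcard⟩ := hpts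
    -- Each input has at least `⌊N/K⌋ ≥ S + 2A + 1` copies, so one lies in `R`.
    have hex (k : Fin K) : ∃ i ∈ R, σ i = k := by
      by_contra! hcon
      have h1 : S + 2 * A + 1 ≤ N / K := (Nat.le_div_iff_mul_le hK).2 (by rwa [mul_comm])
      have h2 := h1.trans (hcard k).1
      have h3 : {i | σ i = k}.ncard ≤ (Finset.univ \ R).card := by
        rw [← Set.ncard_coe_finset]
        refine Set.ncard_le_ncard (fun i hi => ?_) (Finset.finite_toSet _)
        simp only [Finset.coe_sdiff, Finset.coe_univ, Set.mem_sdiff, Set.mem_univ, true_and,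
          Finset.mem_coe]
        exact fun h => hcon i h hi
      have h4 := Finset.card_sdiff_add_card_eq_card (Finset.subset_univ R)
      rw [Finset.card_univ, Fintype.card_fin] at h4
      omega
    choose i hi hik using hex
    refine ⟨fun k j => if j = i k then 1 else 0, fun X Z k => ?_⟩
    have key : f ((lagrangeEncoder α β).encode X Z (i k)) = f (X k) := by
      rw [lagrangeEncoder_encode, hσ, lagrangeCurve_node hβ, hik]
      rfl
    refine ((Finset.sum_eq_single_of_mem (i k) (hi k) fun j _ hj => by simp [hj]).trans ?_).symm
    change (if i k = i k then (1 : F) else 0) • _ = _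
    rw [if_pos rfl, one_smul, key]

/-- To hide a change of input `j`, add a polynomial equal to `1` at its node and `0` at the other
data nodes and at the observed `α i`. At most `K + T` conditions leave degree below `K + T`, so it
is an admissible curve, and its values at the key nodes are the required shift. -/
theorem lagrangeEncoder_isPrivate (hK : 0 < K) {d : ℕ} {α : Fin N → F} {β : Fin K ⊕ Fin T → F}
    (hpts : IsLCCPoints d α β) (hT : 0 < T → Finite V) :
    (lagrangeEncoder α β).IsPrivate V T := by
  classical
  rcases Nat.eq_zero_or_pos T with rfl | hT0
  · exact LinearEncoder.isPrivate_zero _ hK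
  have := hT hT0
  unfold IsLCCPoints at hpts
  rw [if_pos (Or.inl hT0)] at hpts
  obtain ⟨hα, hβ, hαβ⟩ := hpts
  refine LinearEncoder.isPrivate_of_shift _ fun C hC => ?_
  let node : Fin K ⊕ C → F := Sum.elim (fun j => β (Sum.inl j)) (fun i => α i)
  have hnode : Function.Injective node := by
    refine Function.Injective.sumElim (hβ.comp Sum.inl_injective)
      (hα.comp Subtype.val_injective) fun j i h => hαβ hT0 i j h.symm
  let u : Fin K → F[X] := fun j =>
    Lagrange.interpolate Finset.univ node (Sum.elim (Pi.single j 1) 0)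
  have hu (j : Fin K) (x : Fin K ⊕ C) :
      (u j).eval (node x) = (Sum.elim (Pi.single j 1) 0 : Fin K ⊕ C → F) x :=
    Lagrange.eval_interpolate_at_node _ hnode.injOn (Finset.mem_univ x)
  have hdeg (j : Fin K) : (u j).degree < (Finset.univ : Finset (Fin K ⊕ Fin T)).card := by
    refine (Lagrange.degree_interpolate_lt _ hnode.injOn).trans_le ?_
    rw [Nat.cast_le]
    simpa using hC
  refine ⟨fun l j => (u j).eval (β (Sum.inr l)), fun i hi j => ?_⟩
  have h := congrArg (eval (α i)) (Lagrange.eq_interpolate hβ.injOn (hdeg j))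
  rw [Lagrange.interpolate_apply, eval_finsetSum, Fintype.sum_sum_type] at h
  have h0 := hu j (Sum.inr ⟨i, hi⟩)
  simp only [node, Sum.elim_inr, Pi.zero_apply] at h0
  have h1 (k : Fin K) : (u j).eval (β (Sum.inl k)) = (Pi.single j 1 : Fin K → F) k :=
    hu j (Sum.inl k)
  simp only [eval_mul, eval_C, h0, h1, Pi.single_apply, ite_mul, one_mul, zero_mul,
    Finset.sum_ite_eq', Finset.mem_univ, if_true] at h
  rw [h]
  simp only [lagrangeEncoder, mul_comm]
  rfl

theorem achieves_of_decoder {E : LinearEncoder F K N} {U : Type*} [AddCommGroup U] [Module F U]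
    {D : Set (Decoder K N U)} {f : V → U} {S A : ℕ} (hkeys : E.numKeys ≠ 0 → Finite V)
    (hpriv : E.IsPrivate V T) (h : Decoder K N U) (hD : h ∈ D)
    (hdec : ∀ (X : Fin K → V) (Z : Fin E.numKeys → V) (R : Finset (Fin N)), N ≤ R.card + S →
      ∀ y : R → U, {i : R | y i ≠ f (E.encode X Z i)}.ncard ≤ A → h R y = fun k => f (X k)) :
    E.Achieves.{w} D f S A T :=
  ⟨hkeys, hpriv, PUnit, ⊤, Measure.dirac PUnit.unit, fun _ => h,
    @Measure.dirac.isProbabilityMeasure _ ⊤ _, fun _ => hD,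
    fun X Z R hR y hy => Filter.Eventually.of_forall fun _ => hdec X Z R hR y hy⟩

theorem lagrangeEncoder_achieves_linear {U : Type*} [AddCommGroup U] [Module F U] {f : V → U}
    (hK : 0 < K) {d S : ℕ} (hreg : InRegion N K d S 0 T) {α : Fin N → F}
    {β : Fin K ⊕ Fin T → F} (hpts : IsLCCPoints d α β) (hT : 0 < T → Finite V)
    (hf : Function.Injective β → ∀ x : Fin K ⊕ Fin T → V,
      (fun t => f (lagrangeCurve β x t)) ∈ polyCurves F U ((K + T - 1) * d)) :
    (lagrangeEncoder α β).Achieves.{w} (linearDecoders F K N U) f S 0 T := by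
  classical
  have hex (R : Finset (Fin N)) : ∃ c : Fin K → Fin N → F, N ≤ R.card + S →
      ∀ (X : Fin K → V) (Z : Fin T → V) (k : Fin K),
        f (X k) = ∑ i ∈ R, c k i • f ((lagrangeEncoder α β).encode X Z i) := by
    by_cases hR : N ≤ R.card + S
    · obtain ⟨c, hc⟩ := exists_coeff_of_inRegion hK hreg hpts hf (R := R) (by omega)
      exact ⟨c, fun _ => hc⟩
    · exact ⟨0, fun h => absurd h hR⟩
  choose c hc using hex
  refine achieves_of_decoder (fun h => hT (Nat.pos_of_ne_zero h))
    (lagrangeEncoder_isPrivate hK hpts hT) (fun R y k => ∑ i : R, c R k i • y i)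
    (fun R => ⟨fun k i => c R k i, fun _ _ => rfl⟩) fun X Z R hR y hy => ?_
  funext k
  rw [hc R hR X Z k, ← Finset.sum_coe_sort R]
  refine Finset.sum_congr rfl fun i _ => ?_
  rw [Nat.le_zero, Set.ncard_eq_zero (Set.toFinite _)] at hy
  have : i ∉ {i : R | y i ≠ f ((lagrangeEncoder α β).encode X Z i)} := by simp [hy]
  rw [not_not.1 this]

/-- Minimum-distance decoding: any data within `A` errors of the received results agrees with the
true data off at most `2A` workers, and the remaining results determine the outputs. -/
theorem lagrangeEncoder_achieves {U : Type*} [AddCommGroup U] [Module F U] {f : V → U}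
    (hK : 0 < K) {d S A : ℕ} (hreg : InRegion N K d S A T) {α : Fin N → F}
    {β : Fin K ⊕ Fin T → F} (hpts : IsLCCPoints d α β) (hT : 0 < T → Finite V)
    (hf : Function.Injective β → ∀ x : Fin K ⊕ Fin T → V,
      (fun t => f (lagrangeCurve β x t)) ∈ polyCurves F U ((K + T - 1) * d)) :
    (lagrangeEncoder α β).Achieves.{w} Set.univ f S A T := by
  classical
  let E := lagrangeEncoder α β
  let dec : Decoder K N U := fun (R : Finset (Fin N)) (y : R → U) =>
    if h : ∃ (X : Fin K → V) (Z : Fin T → V), {i : R | y i ≠ f (E.encode X Z i)}.ncard ≤ A then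
      fun k => f (h.choose k) else 0
  refine achieves_of_decoder (fun h => hT (Nat.pos_of_ne_zero h))
    (lagrangeEncoder_isPrivate hK hpts hT) dec (Set.mem_univ _) fun X Z R hR y hy => ?_
  have hex : ∃ (X : Fin K → V) (Z : Fin T → V), {i : R | y i ≠ f (E.encode X Z i)}.ncard ≤ A :=
    ⟨X, Z, hy⟩
  simp only [dec, dif_pos hex]
  obtain ⟨Z', hy'⟩ := hex.choose_spec
  set X' := hex.choose
  set B := (Finset.univ : Finset R).filter fun i => y i ≠ f (E.encode X Z i)
  set B' := (Finset.univ : Finset R).filter fun i => y i ≠ f (E.encode X' Z' i)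
  have hB : B.card ≤ A := by
    rw [← Set.ncard_coe_finset]; simpa [B] using hy
  have hB' : B'.card ≤ A := by
    rw [← Set.ncard_coe_finset]; simpa [B'] using hy'
  have hcard := Finset.card_sdiff_add_card_eq_card (Finset.subset_univ (B ∪ B'))
  have hunion := Finset.card_union_le B B'
  rw [Finset.card_univ, Fintype.card_coe] at hcard
  obtain ⟨c, hc⟩ := exists_coeff_of_inRegion hK hreg hpts hf
    (R := (Finset.univ \ (B ∪ B')).map (Function.Embedding.subtype _))
    (by rw [Finset.card_map]; omega)
  funext k
  rw [hc X Z k, hc X' Z' k, Finset.sum_map, Finset.sum_map]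
  refine Finset.sum_congr rfl fun i hi => ?_
  simp only [B, B', Finset.mem_sdiff, Finset.mem_univ, true_and, Finset.mem_union,
    Finset.mem_filter, not_or, not_not] at hi
  congr 1
  exact hi.2.symm.trans hi.1

end Lagrange

/-! ### Existence of admissible points. -/

section Points

theorem exists_isLCCPoints {F : Type*} [Field F] {N K T : ℕ} (hK : 0 < K)
    (hF : ((N + K + T : ℕ) : ℕ∞) ≤ ENat.card F) (d : ℕ) :
    ∃ (α : Fin N → F) (β : Fin K ⊕ Fin T → F), IsLCCPoints d α β := by
  obtain ⟨g⟩ : Nonempty (Fin N ⊕ (Fin K ⊕ Fin T) ↪ F) := by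
    rcases finite_or_infinite F with h | h
    · have := Fintype.ofFinite F
      rw [ENat.card_eq_coe_fintype_card, Nat.cast_le] at hF
      exact Function.Embedding.nonempty_of_card_le (by simpa [add_assoc] using hF)
    · exact ⟨(Fintype.equivFin _).toEmbedding.trans
        (Fin.valEmbedding.trans (Infinite.natEmbedding F))⟩
  have hβ : Function.Injective (g ∘ Sum.inr) := g.injective.comp Sum.inr_injective
  by_cases hcase : 0 < T ∨ K * d ≤ N + 1
  · refine ⟨g ∘ Sum.inl, g ∘ Sum.inr, ?_⟩
    rw [IsLCCPoints, if_pos hcase]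
    exact ⟨g.injective.comp Sum.inl_injective, hβ, fun _ i j h => by
      simpa using g.injective h⟩
  -- Round-robin assignment keeps the replication numbers between the floor and the ceiling of `N /
  -- K`.
  · let σ : Fin N → Fin K := fun i => ⟨i % K, Nat.mod_lt _ hK⟩
    refine ⟨fun i => g (Sum.inr (Sum.inl (σ i))), g ∘ Sum.inr, ?_⟩
    rw [IsLCCPoints, if_neg hcase]
    refine ⟨hβ, σ, fun i => rfl, fun j => ⟨?_, ?_⟩⟩
    · have hlt (q : Fin (N / K)) : j + K * q < N := by
        have h1 : K * (q + 1) ≤ K * (N / K) := Nat.mul_le_mul_left K q.2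
        have h2 := Nat.mul_div_le N K
        have h3 := j.2
        rw [mul_add, mul_one] at h1
        omega
      have hinj : Function.Injective fun q : Fin (N / K) => (⟨j + K * q, hlt q⟩ : Fin N) := by
        intro q q' h
        simpa [Fin.ext_iff, hK.ne'] using h
      have := Set.ncard_le_ncard (s := Set.range fun q : Fin (N / K) =>
        (⟨j + K * q, hlt q⟩ : Fin N)) (t := {i | σ i = j}) (by
          rintro _ ⟨q, rfl⟩
          simp [σ, Fin.ext_iff, Nat.mod_eq_of_lt j.2]) (Set.toFinite _)
      rwa [← Set.image_univ, Set.ncard_image_of_injective _ hinj, Set.ncard_univ, Nat.card_fin]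
        at this
    · rw [Nat.ceilDiv_eq_add_pred_div]
      have hmaps : ∀ i ∈ {i : Fin N | σ i = j}, (i : ℕ) / K ∈
          ((Finset.range ((N + K - 1) / K) : Finset ℕ) : Set ℕ) := by
        intro i _
        rw [Finset.mem_coe, Finset.mem_range, Nat.div_lt_iff_lt_mul hK]
        have h1 := Nat.lt_div_mul_add (a := N + K - 1) hK
        have h2 := i.2
        omega
      refine (Set.ncard_le_ncard_of_injOn (fun i : Fin N => (i : ℕ) / K) hmaps ?_
        (Finset.finite_toSet _)).trans ?_
      · intro i hi i' hi' h
        have h1 : (i : ℕ) % K = j := congrArg Fin.val hi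
        have h2 : (i' : ℕ) % K = j := congrArg Fin.val hi'
        have h : (i : ℕ) / K = i' / K := h
        refine Fin.ext ?_
        rw [← Nat.div_add_mod i K, ← Nat.div_add_mod i' K, h, h1, h2]
      · rw [Set.ncard_coe_finset, Finset.card_range]

end Points

end CodedComputing

theorem theorem2 {F : Type u} [Field F] {U : Type v'} [AddCommGroup U] [Module F U]
    (N K S T : ℕ) (hK : 0 < K) :
    -- multilinear functions, arbitrary decoding
    (∀ (A d : ℕ) (W : Fin d → Type v) [∀ j, AddCommGroup (W j)] [∀ j, Module F (W j)]
        (f : MultilinearMap F W U), 0 < d → f ≠ 0 → (0 < T → Finite (∀ j, W j)) →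
      (∀ E : CodedComputing.LinearEncoder F K N,
        E.Achieves.{w} Set.univ (fun x => f x) S A T → CodedComputing.InRegion N K d S A T) ∧
      (CodedComputing.InRegion N K d S A T →
        ∀ (α : Fin N → F) (β : Fin K ⊕ Fin T → F), CodedComputing.IsLCCPoints d α β →
          (CodedComputing.lagrangeEncoder α β).Achieves.{w} Set.univ (fun x => f x) S A T) ∧
      (((N + K + T : ℕ) : ℕ∞) ≤ ENat.card F →
        (∃ E : CodedComputing.LinearEncoder F K N,
          E.Achieves.{w} Set.univ (fun x => f x) S A T) →
        ∃ (α : Fin N → F) (β : Fin K ⊕ Fin T → F), CodedComputing.IsLCCPoints d α β ∧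
          (CodedComputing.lagrangeEncoder α β).Achieves.{w} Set.univ (fun x => f x) S A T)) ∧
    -- arbitrary polynomials, no adversary, linear decoding
    (∀ (V : Type v) [AddCommGroup V] [Module F V] (M L : ℕ)
        (b : Module.Basis (Fin M) F V) (c : Module.Basis (Fin L) F U)
        (p : Fin L → MvPolynomial (Fin M) F) (f : V → U) (d : ℕ),
        CodedComputing.IsCanonical p → f = CodedComputing.polyMap b c p →
        d = CodedComputing.polyDegree p → (∃ x y, f x ≠ f y) →
        (ringChar F = 0 ∨ d < ringChar F) → (0 < T → Finite V) →
      (∀ E : CodedComputing.LinearEncoder F K N,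
        E.Achieves.{w} (CodedComputing.linearDecoders F K N U) f S 0 T →
          CodedComputing.InRegion N K d S 0 T) ∧
      (CodedComputing.InRegion N K d S 0 T →
        ∀ (α : Fin N → F) (β : Fin K ⊕ Fin T → F), CodedComputing.IsLCCPoints d α β →
          (CodedComputing.lagrangeEncoder α β).Achieves.{w}
            (CodedComputing.linearDecoders F K N U) f S 0 T) ∧
      (((N + K + T : ℕ) : ℕ∞) ≤ ENat.card F →
        (∃ E : CodedComputing.LinearEncoder F K N,
          E.Achieves.{w} (CodedComputing.linearDecoders F K N U) f S 0 T) →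
        ∃ (α : Fin N → F) (β : Fin K ⊕ Fin T → F), CodedComputing.IsLCCPoints d α β ∧
          (CodedComputing.lagrangeEncoder α β).Achieves.{w}
            (CodedComputing.linearDecoders F K N U) f S 0 T)) := by
  refine ⟨fun A d W _ _ f hd hf hT => ?_,
    fun V _ _ M L b c p f d _ hfp hdp hne hchar hT => ?_⟩
  · have hconv (E : CodedComputing.LinearEncoder F K N)
        (hE : E.Achieves.{w} Set.univ (fun x => f x) S A T) :
        CodedComputing.InRegion N K d S A T :=
      CodedComputing.inRegion_of_achieves_multilinear hK hd hf hT hE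
    have hach (hreg : CodedComputing.InRegion N K d S A T) (α : Fin N → F)
        (β : Fin K ⊕ Fin T → F) (hpts : CodedComputing.IsLCCPoints d α β) :
        (CodedComputing.lagrangeEncoder α β).Achieves.{w} Set.univ (fun x => f x) S A T := by
      refine CodedComputing.lagrangeEncoder_achieves hK hreg hpts hT fun hβ x => ?_
      simpa using CodedComputing.multilinear_comp_lagrangeCurve_mem f hβ x
    refine ⟨hconv, hach, fun hF ⟨E, hE⟩ => ?_⟩
    obtain ⟨α, β, hpts⟩ := CodedComputing.exists_isLCCPoints hK hF d
    exact ⟨α, β, hpts, hach (hconv E hE) α β hpts⟩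
  · subst hfp hdp
    have hconv (E : CodedComputing.LinearEncoder F K N)
        (hE : E.Achieves.{w} (CodedComputing.linearDecoders F K N U)
          (CodedComputing.polyMap b c p) S 0 T) :
        CodedComputing.InRegion N K (CodedComputing.polyDegree p) S 0 T :=
      CodedComputing.inRegion_of_achieves_polynomial hK b c p hne hchar hT hE
    have hach (hreg : CodedComputing.InRegion N K (CodedComputing.polyDegree p) S 0 T)
        (α : Fin N → F) (β : Fin K ⊕ Fin T → F)
        (hpts : CodedComputing.IsLCCPoints (CodedComputing.polyDegree p) α β) :
        (CodedComputing.lagrangeEncoder α β).Achieves.{w}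
          (CodedComputing.linearDecoders F K N U) (CodedComputing.polyMap b c p) S 0 T := by
      refine CodedComputing.lagrangeEncoder_achieves_linear hK hreg hpts hT fun hβ x => ?_
      simpa using CodedComputing.polyMap_comp_lagrangeCurve_mem b c p hβ x
    refine ⟨hconv, hach, fun hF ⟨E, hE⟩ => ?_⟩
    obtain ⟨α, β, hpts⟩ :=
      CodedComputing.exists_isLCCPoints hK hF (CodedComputing.polyDegree p)
    exact ⟨α, β, hpts, hach (hconv E hE) α β hpts⟩
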